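/- Let $\Delta$ be a holomorphic distribution of complex hyperplanes in $\mathbb C^3$; that is, $\Delta$ assigns to each $q\in\mathbb C^3$ a complex plane $\Delta_q\subset T_q\mathbb C^3=\mathbb C^3$, and near every point $\Delta=\ker\omega$ for some nowhere vanishing holomorphic $1$-form $\omega$. An admissible holomorphic curve is a holomorphic map $\gamma\colon D\to\mathbb C^3$, with $D\subset\mathbb C$ a nonempty connected open set, such that $\gamma'(t)\in\Delta_{\gamma(t)}$ for all $t\in D$. Suppose that for every point $p\in\mathbb C^3$ and every open neighbourhood $U$ of $p$ there is a point $q\in U$ that is inaccessible from $p$ in $U$: no admissible holomorphic curve $\gamma\colon D\to U$ passes through both $p$ and $q$. (This is the case, in particular, if no admissible holomorphic curve in $\mathbb C^3$ passes through both $p$ and $q$.) Then $\Delta$ is integrable: every point $p\in\mathbb C^3$ has an open neighbourhood $V$ with a biholomorphic map $\Phi=(\Phi_1,\Phi_2,\Phi_3)$ from $V$ onto a polydisc centred at $\Phi(p)=0$ such that $\Delta_q=\ker d\Phi_3(q)$ for all $q\in V$, so that $V$ is foliated by the complex surfaces $\{\Phi_3=\mathrm{const}\}$, which are tangent to $\Delta$.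 Moreover, $\omega\wedge d\omega\equiv 0$ on $U$ for every open set $U\subset\mathbb C^3$ and every nowhere vanishing holomorphic $1$-form $\omega$ on $U$ with $\Delta=\ker\omega$ on $U$. -/

import Mathlib

namespace HolDist

/-- Complex three-space. -/
abbrev C3 : Type := Fin 3 → ℂ

/-- A field of complex linear subspaces of the tangent spaces of `C3` (each identified with `C3`). -/
abbrev PlaneField : Type := C3 → Submodule ℂ C3

/-- A differential 1-form of type (1,0), as a field of complex linear functionals. -/
abbrev OneForm : Type := C3 → (C3 →L[ℂ] ℂ)

/-- On the set `U` the field `Δ` is the field of kernels of the nowhere vanishing holomorphic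
1-form `ω`.  (The values of `ω` outside `U` play no role.) -/
structure DefinesOn (ω : OneForm) (U : Set C3) (Δ : PlaneField) : Prop where
  holomorphic : DifferentiableOn ℂ ω U
  ne_zero : ∀ q ∈ U, ω q ≠ 0
  mem_iff : ∀ q ∈ U, ∀ v : C3, v ∈ Δ q ↔ ω q v = 0

/-- A holomorphic distribution of complex hyperplanes: near every point it is the field of kernels
of a nowhere vanishing holomorphic 1-form. -/
def IsHolomorphicHyperplaneDistribution (Δ : PlaneField) : Prop :=
  ∀ p : C3, ∃ U : Set C3, IsOpen U ∧ p ∈ U ∧ ∃ ω : OneForm, DefinesOn ω U Δ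

/-- `γ`, restricted to the domain `D` of the complex parameter plane, is a holomorphic curve that is
admissible for (tangent to) `Δ`. -/
structure IsAdmissibleCurve (Δ : PlaneField) (D : Set ℂ) (γ : ℂ → C3) : Prop where
  isOpen : IsOpen D
  isConnected : IsConnected D
  holomorphic : DifferentiableOn ℂ γ D
  tangent : ∀ t ∈ D, deriv γ t ∈ Δ (γ t)

/-- The point `q` is accessible from `p` inside `U`: some admissible holomorphic curve lying in `U`
passes through both `p` and `q`. -/
def AccessibleWithin (Δ : PlaneField) (U : Set C3) (p q : C3) : Prop :=
  ∃ (D : Set ℂ) (γ : ℂ → C3), IsAdmissibleCurve Δ D γ ∧ (∀ t ∈ D, γ t ∈ U) ∧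
    ∃ s ∈ D, ∃ t ∈ D, γ s = p ∧ γ t = q

/-- The exterior derivative of a 1-form, an alternating 2-form at every point. -/
noncomputable def dOne (ω : OneForm) (q : C3) : C3 [⋀^Fin 2]→L[ℂ] ℂ :=
  extDeriv (fun x : C3 => ContinuousAlternatingMap.ofSubsingleton ℂ C3 ℂ (0 : Fin 1) (ω x)) q

/-- The exterior product of a linear functional and an alternating 2-form, evaluated on three
vectors. -/
noncomputable def wedgeOneTwo (α : C3 →L[ℂ] ℂ) (β : C3 [⋀^Fin 2]→L[ℂ] ℂ) (u v w : C3) : ℂ :=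
  α u * β ![v, w] - α v * β ![u, w] + α w * β ![u, v]

/-- `Φ` is a foliation chart centred at `p` with leaves tangent to `Δ`: a biholomorphic map of an
open neighbourhood of `p` onto a polydisc (a ball of the sup norm) centred at `Φ p = 0`, such that
the complex surfaces on which the last coordinate of `Φ` is constant, which fill the neighbourhood,
have at each of their points `q` the tangent plane `Δ q`; this tangent plane consists of the
vectors `v` for which the last coordinate of `DΦ(q) v` vanishes. -/
structure IsFoliationChart (Δ : PlaneField) (p : C3) (Φ : OpenPartialHomeomorph C3 C3) : Prop where
  mem_source : p ∈ Φ.source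
  map_center : Φ p = 0
  target_eq : ∃ r : ℝ, 0 < r ∧ Φ.target = Metric.ball (0 : C3) r
  holomorphic : DifferentiableOn ℂ Φ Φ.source
  holomorphic_symm : DifferentiableOn ℂ Φ.symm Φ.target
  tangent : ∀ q ∈ Φ.source, ∀ v : C3, v ∈ Δ q ↔ (fderiv ℂ Φ q v) 2 = 0

/-- The distribution is integrable: the space is locally foliated by complex surfaces whose tangent
planes are the planes of the distribution. -/
def IsIntegrable (Δ : PlaneField) : Prop :=
  ∀ p : C3, ∃ Φ : OpenPartialHomeomorph C3 C3, IsFoliationChart Δ p Φ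

end HolDist

/-! Near any point, coordinates can be chosen in which Δ is the kernel of dz - f dx: write Δ as the
kernel of a dx + b dy + dz and remove the dy term by solving ∂Z/∂y = -b(x, y, Z)
(`exists_localModel_slope`). Everything is then decided by ∂f/∂y.

If ∂f/∂y is nonzero at some point near the origin, Δ is contact there, and a change of coordinates
gives the model dz - y dx (`LocalModel.darboux`). For this model a three-parameter family of
polynomial curves through the origin, with z = ∫ y dx, has an open endpoint map
(`isOpenMap_endpoint`). The image of a small parameter ball is therefore a neighbourhood U of the
point, and each point of U is joined to the centre by an admissible curve inside U
(`LocalModel.exists_accessible`). This contradicts inaccessibility, which is assumed at every point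
and not only at p.

Hence ∂f/∂y vanishes near the origin, so f depends on x and z only. The solutions of dz/dx = f(x, z)
straighten Δ to the kernel of dz (`LocalModel.flatten`), and the inverse of the coordinate map is a
foliation chart. Finally, in such a chart any defining form is ω = h dφ, with φ the last coordinate,
whence ω ∧ dω = h dφ ∧ dh ∧ dφ = 0.

The analytic groundwork consists of Cauchy estimates, holomorphy of derivatives in several
variables, and Picard iteration with holomorphic dependence on parameters (`exists_flow`). -/

namespace HolDist

open Filter Topology Metric Set

/-! ### Holomorphic maps of several variables: Cauchy estimates, uniform limits, derivatives. -/

section SeveralVariables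

variable {E F : Type*} [NormedAddCommGroup E] [NormedSpace ℂ E]
  [NormedAddCommGroup F] [NormedSpace ℂ F]

/-- Cauchy estimate for the derivative of a holomorphic map bounded by `M` on a ball. -/
theorem norm_fderiv_le_of_bound {f : E → F} {c : E} {R M : ℝ} (hR : 0 < R)
    (hf : DifferentiableOn ℂ f (ball c R)) (hM : ∀ z ∈ ball c R, ‖f z‖ ≤ M) :
    ‖fderiv ℂ f c‖ ≤ 2 * M / R := by
  refine Complex.norm_fderiv_le_div_of_mapsTo_ball hf (fun z hz => ?_) hR
  rw [mem_closedBall, dist_eq_norm]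
  linarith [norm_sub_le (f z) (f c), hM z hz, hM c (mem_ball_self hR)]

/-- A uniform limit of holomorphic maps on a ball is holomorphic. -/
theorem differentiableOn_of_tendstoUniformlyOn [CompleteSpace F] {f : ℕ → E → F} {g : E → F}
    {c : E} {R : ℝ} (hf : ∀ n, DifferentiableOn ℂ (f n) (ball c R))
    (hfg : TendstoUniformlyOn f g atTop (ball c R)) : DifferentiableOn ℂ g (ball c R) := by
  intro x hx
  obtain ⟨ρ, hρ, hsub⟩ : ∃ ρ > 0, ball x (ρ + ρ) ⊆ ball c R := by
    obtain ⟨ε, hε, h⟩ := Metric.isOpen_iff.1 isOpen_ball x hx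
    exact ⟨ε / 2, by positivity, by simpa using h⟩
  have hsub' : ∀ y ∈ ball x ρ, ball y ρ ⊆ ball c R := fun y hy => by
    refine (ball_subset_ball' ?_).trans hsub
    rw [mem_ball] at hy; linarith
  have hmem : ∀ y ∈ ball x ρ, y ∈ ball c R := fun y hy => hsub' y hy (mem_ball_self hρ)
  have hdiff : ∀ n, ∀ y ∈ ball x ρ, DifferentiableAt ℂ (f n) y := fun n y hy =>
    (hf n).differentiableAt (isOpen_ball.mem_nhds (hmem y hy))
  have hcau : UniformCauchySeqOn (fun n => fderiv ℂ (f n)) atTop (ball x ρ) := by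
    rw [Metric.uniformCauchySeqOn_iff]
    intro ε hε
    -- With this bound on f m - f n, the Cauchy estimate on balls of radius ρ gives ε / 2.
    obtain ⟨N, hN⟩ := (Metric.uniformCauchySeqOn_iff.1 hfg.uniformCauchySeqOn) (ε * ρ / 4)
      (by positivity)
    refine ⟨N, fun m hm n hn y hy => ?_⟩
    have h := norm_fderiv_le_of_bound (f := f m - f n) (M := ε * ρ / 4) hρ
      (((hf m).sub (hf n)).mono (hsub' y hy)) (fun z hz => by
        have := hN m hm n hn z (hsub' y hy hz)
        rw [dist_eq_norm] at this
        exact this.le)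
    rw [fderiv_sub (hdiff m y hy) (hdiff n y hy)] at h
    rw [dist_eq_norm]
    refine h.trans_lt ?_
    rw [div_lt_iff₀ hρ]; nlinarith [mul_pos hε hρ]
  have hlim : ∀ y ∈ ball x ρ, ∃ L, Tendsto (fun n => fderiv ℂ (f n) y) atTop (𝓝 L) := fun y hy =>
    cauchySeq_tendsto_of_complete (hcau.cauchySeq hy)
  choose! L hL using hlim
  have hunif := hcau.tendstoUniformlyOn_of_tendsto hL
  exact (hasFDerivAt_of_tendstoUniformlyOn isOpen_ball hunif
    (fun n y hy => (hdiff n y hy).hasFDerivAt)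
    (fun y hy => hfg.tendsto_at (hmem y hy))
    (mem_ball_self hρ)).differentiableAt.differentiableWithinAt

/-- Second order Taylor estimate for bounded holomorphic maps. -/
theorem norm_sub_sub_fderiv_le {f : E → F} {c : E} {R M : ℝ} (hR : 0 < R)
    (hf : DifferentiableOn ℂ f (ball c R)) (hM : ∀ z ∈ ball c R, ‖f z‖ ≤ M) {z : E}
    (hz : z ∈ ball c R) :
    ‖f z - f c - fderiv ℂ f c (z - c)‖ ≤ 4 * M * (‖z - c‖ / R) ^ 2 := by
  have hM0 : 0 ≤ M := (norm_nonneg _).trans (hM c (mem_ball_self hR))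
  have hd : HasFDerivAt f (fderiv ℂ f c) c :=
    (hf.differentiableAt (ball_mem_nhds c hR)).hasFDerivAt
  -- Higher-order Schwarz lemma for f minus its linear part; 4M = M + 2M + M bounds f w, the linear
  -- term (by Cauchy) and f c.
  have h := Complex.dist_le_mul_div_pow_of_mapsTo_ball_of_isLittleO (n := 1) (R₂ := 4 * M)
    (f := fun w => f w - fderiv ℂ f c (w - c)) (c := c) (R₁ := R) (z := z)
    (hf.sub (by fun_prop)) ?_ ?_ hz
  · simp only [sub_self, map_zero, sub_zero, dist_eq_norm] at h
    rwa [show f z - f c - fderiv ℂ f c (z - c) = f z - fderiv ℂ f c (z - c) - f c by abel]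
  · intro w hw
    simp only [sub_self, map_zero, sub_zero, mem_closedBall, dist_eq_norm]
    have h1 := (fderiv ℂ f c).le_opNorm (w - c)
    have h2 := norm_fderiv_le_of_bound hR hf hM
    rw [mem_ball, dist_eq_norm] at hw
    have h3 : ‖fderiv ℂ f c‖ * ‖w - c‖ ≤ 2 * M / R * R := by gcongr
    rw [div_mul_cancel₀ _ hR.ne'] at h3
    calc ‖f w - fderiv ℂ f c (w - c) - f c‖
        ≤ ‖f w‖ + ‖fderiv ℂ f c (w - c)‖ + ‖f c‖ :=
          (norm_sub_le _ _).trans (by gcongr; exact norm_sub_le _ _)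
      _ ≤ 4 * M := by
          linarith [hM w (by rwa [mem_ball, dist_eq_norm]), hM c (mem_ball_self hR)]
  · simp only [sub_self, map_zero, sub_zero, pow_one]
    have := hd.isLittleO.norm_right
    refine this.congr_left fun w => by abel

/-- Directional derivatives of a bounded holomorphic map are holomorphic. -/
theorem differentiableOn_fderiv_apply [CompleteSpace F] {f : E → F} {c : E} {R M : ℝ}
    (hf : DifferentiableOn ℂ f (ball c (R + R))) (hM : ∀ z ∈ ball c (R + R), ‖f z‖ ≤ M) (u : E) :
    DifferentiableOn ℂ (fun x => fderiv ℂ f x u) (ball c R) := by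
  rcases le_or_gt R 0 with hR | hR
  · rw [ball_eq_empty.2 hR]; exact differentiableOn_empty
  have hM0 : 0 ≤ M := (norm_nonneg _).trans (hM c (mem_ball_self (by positivity)))
  obtain ⟨δ, hδ, hδu⟩ : ∃ δ : ℝ, 0 < δ ∧ δ * ‖u‖ < R :=
    ⟨R / (‖u‖ + 1), by positivity, by
      rw [div_mul_eq_mul_div, div_lt_iff₀ (by positivity)]; nlinarith [norm_nonneg u]⟩
  have hsub : ∀ x ∈ ball c R, ball x R ⊆ ball c (R + R) := fun x hx =>
    ball_subset_ball' (by rw [mem_ball] at hx; linarith)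
  set h : ℕ → ℝ := fun n => δ / (n + 1) with hh
  have hpos : ∀ n, 0 < h n := fun n => by simp only [hh]; positivity
  have hle : ∀ n, h n ≤ δ := fun n => div_le_self hδ.le (by linarith [n.cast_nonneg (α := ℝ)])
  have hn : ∀ n, ‖(h n : ℂ)‖ = h n := fun n => by
    rw [Complex.norm_real, Real.norm_of_nonneg (hpos n).le]
  have hin : ∀ n, ∀ x : E, x + (h n : ℂ) • u ∈ ball x R := fun n x => by
    rw [mem_ball, dist_eq_norm, add_sub_cancel_left, norm_smul, hn]
    exact (mul_le_mul_of_nonneg_right (hle n) (norm_nonneg u)).trans_lt hδu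
  -- The difference quotients are holomorphic, and the Taylor estimate makes their error O(h n)
  -- uniformly in x.
  refine differentiableOn_of_tendstoUniformlyOn
    (f := fun n x => (h n : ℂ)⁻¹ • (f (x + (h n : ℂ) • u) - f x)) (fun n => ?_) ?_
  · refine DifferentiableOn.const_smul (DifferentiableOn.sub ?_ ?_) _
    · exact hf.comp (by fun_prop) fun x hx => hsub x hx (hin n x)
    · exact hf.mono (ball_subset_ball (by linarith))
  · rw [Metric.tendstoUniformlyOn_iff]
    intro ε hε
    have hlim : Tendsto (fun n : ℕ => 4 * M * (‖u‖ / R) ^ 2 * h n) atTop (𝓝 0) := by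
      have : Tendsto (fun n : ℕ => δ / ((n : ℝ) + 1)) atTop (𝓝 0) :=
        tendsto_const_nhds.div_atTop
          (tendsto_atTop_add_const_right _ _ tendsto_natCast_atTop_atTop)
      simpa using this.const_mul (4 * M * (‖u‖ / R) ^ 2)
    filter_upwards [hlim.eventually (gt_mem_nhds hε)] with n hnε x hx
    refine lt_of_le_of_lt ?_ hnε
    have key := norm_sub_sub_fderiv_le hR (hf.mono (hsub x hx))
      (fun z hz => hM z (hsub x hx hz)) (hin n x)
    rw [add_sub_cancel_left, norm_smul, hn] at key
    have hne : (h n : ℂ) ≠ 0 := by exact_mod_cast (hpos n).ne'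
    have heq : (h n : ℂ)⁻¹ • (f (x + (h n : ℂ) • u) - f x) - fderiv ℂ f x u
        = (h n : ℂ)⁻¹ • (f (x + (h n : ℂ) • u) - f x - fderiv ℂ f x ((h n : ℂ) • u)) := by
      rw [smul_sub _ (f _ - f _), map_smul, inv_smul_smul₀ hne]
    rw [dist_comm, dist_eq_norm, heq, norm_smul, norm_inv, hn, inv_mul_le_iff₀ (hpos n)]
    refine key.trans (le_of_eq ?_)
    ring

/-- A basis of `E` identifies `E →L[ℂ] F` with a finite power of `F`, evaluation at the basis
vectors being the coordinates. -/
theorem differentiableOn_clm_of_apply {G : Type*} [NormedAddCommGroup G] [NormedSpace ℂ G]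
    [FiniteDimensional ℂ E] {f : G → E →L[ℂ] F} {s : Set G}
    (h : ∀ y, DifferentiableOn ℂ (fun x => f x y) s) : DifferentiableOn ℂ f s := by
  let d := Module.finrank ℂ E
  have hd : d = Module.finrank ℂ (Fin d → ℂ) := (Module.finrank_fin_fun ℂ).symm
  let e₁ := ContinuousLinearEquiv.ofFinrankEq hd
  let e₂ := (e₁.arrowCongr (1 : F ≃L[ℂ] F)).trans (ContinuousLinearEquiv.piRing (Fin d))
  rw [← Function.id_comp f, ← e₂.symm_comp_self]
  exact e₂.symm.differentiable.comp_differentiableOn (differentiableOn_pi.mpr fun i => h _)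

theorem eventually_differentiableAt_fderiv [FiniteDimensional ℂ E] [CompleteSpace F]
    {f : E → F} {c : E} (hf : ∀ᶠ x in 𝓝 c, DifferentiableAt ℂ f x) :
    ∀ᶠ x in 𝓝 c, DifferentiableAt ℂ (fderiv ℂ f) x := by
  have hb : ∀ᶠ x in 𝓝 c, ‖f x‖ < ‖f c‖ + 1 :=
    hf.self_of_nhds.continuousAt.norm.eventually (gt_mem_nhds (lt_add_one _))
  obtain ⟨r, hr, h⟩ := Metric.eventually_nhds_iff_ball.1 (hf.and hb)
  have hr2 : r / 2 + r / 2 = r := by ring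
  have key : DifferentiableOn ℂ (fderiv ℂ f) (ball c (r / 2)) := by
    refine differentiableOn_clm_of_apply fun u => ?_
    refine differentiableOn_fderiv_apply (M := ‖f c‖ + 1) ?_ ?_ u
    · rw [hr2]; exact fun x hx => (h x hx).1.differentiableWithinAt
    · rw [hr2]; exact fun x hx => (h x hx).2.le
  exact Metric.eventually_nhds_iff_ball.2 ⟨r / 2, by positivity, fun x hx =>
    key.differentiableAt (isOpen_ball.mem_nhds hx)⟩

/-- A map that is complex differentiable near a point is continuously differentiable there. -/
theorem contDiffAt_one_of_eventually [FiniteDimensional ℂ E] [CompleteSpace F]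
    {f : E → F} {c : E} (hf : ∀ᶠ x in 𝓝 c, DifferentiableAt ℂ f x) : ContDiffAt ℂ 1 f c := by
  rw [contDiffAt_one_iff]
  refine ⟨fderiv ℂ f, _, hf.and (eventually_differentiableAt_fderiv hf), ?_, ?_⟩
  · exact fun x hx => hx.2.continuousAt.continuousWithinAt
  · exact fun x hx => hx.1.hasFDerivAt

theorem eventually_differentiableAt {f : E → F} {c : E} (hf : ContDiffAt ℂ 1 f c) :
    ∀ᶠ x in 𝓝 c, DifferentiableAt ℂ f x :=
  (hf.eventually (by simp)).mono fun _ hx => hx.differentiableAt (by simp)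

/-- No order of smoothness is lost, so `ContDiffAt ℂ 1` serves throughout as the notion of a
holomorphic germ. -/
theorem contDiffAt_one_fderiv [FiniteDimensional ℂ E] [CompleteSpace F] {f : E → F} {c : E}
    (hf : ContDiffAt ℂ 1 f c) : ContDiffAt ℂ 1 (fderiv ℂ f) c :=
  contDiffAt_one_of_eventually
    (eventually_differentiableAt_fderiv (eventually_differentiableAt hf))

end SeveralVariables

/-! ### Integration of holomorphic functions along one coordinate. -/

section Flow

/-- Multiplication of the `i`-th coordinate by `θ`. -/
noncomputable def squeeze (i : Fin 3) (θ : ℂ) : C3 →L[ℂ] C3 :=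
  ContinuousLinearMap.pi fun j => (if j = i then θ else 1) • ContinuousLinearMap.proj j

theorem squeeze_apply (i : Fin 3) (θ : ℂ) (q : C3) (j : Fin 3) :
    squeeze i θ q j = (if j = i then θ else 1) * q j := by
  simp only [squeeze, ContinuousLinearMap.coe_pi', smul_apply,
    ContinuousLinearMap.proj_apply, smul_eq_mul]

theorem squeeze_one (i : Fin 3) (q : C3) : squeeze i 1 q = q := by
  ext j; simp [squeeze_apply]

theorem squeeze_single (i : Fin 3) (θ : ℂ) :
    squeeze i θ (Pi.single i 1) = θ • Pi.single i (1 : ℂ) := by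
  ext j
  by_cases h : j = i
  · subst h; simp [squeeze_apply]
  · simp [squeeze_apply, h]

theorem norm_squeeze_apply_le (i : Fin 3) {θ : ℝ} (hθ : θ ∈ Icc (0 : ℝ) 1) (q : C3) :
    ‖squeeze i θ q‖ ≤ ‖q‖ := by
  refine (pi_norm_le_iff_of_nonneg (norm_nonneg q)).2 fun j => ?_
  rw [squeeze_apply, norm_mul]
  have h1 : ‖(if j = i then (θ : ℂ) else 1)‖ ≤ 1 := by
    split_ifs
    · rw [Complex.norm_real, Real.norm_of_nonneg hθ.1]; exact hθ.2
    · simp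
  calc _ ≤ 1 * ‖q‖ := mul_le_mul h1 (norm_le_pi_norm q j) (norm_nonneg _) zero_le_one
    _ = ‖q‖ := one_mul _

theorem squeeze_mem_ball (i : Fin 3) {θ : ℝ} (hθ : θ ∈ Icc (0 : ℝ) 1) {q : C3} {r : ℝ}
    (hq : q ∈ ball (0 : C3) r) : squeeze i θ q ∈ ball (0 : C3) r := by
  rw [mem_ball_zero_iff] at hq ⊢
  exact (norm_squeeze_apply_le i hθ q).trans_lt hq

theorem norm_squeeze_le (i : Fin 3) {θ : ℝ} (hθ : θ ∈ Icc (0 : ℝ) 1) :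
    ‖squeeze i (θ : ℂ)‖ ≤ 1 :=
  ContinuousLinearMap.opNorm_le_bound _ zero_le_one fun q => by
    simpa using norm_squeeze_apply_le i hθ q

theorem continuous_squeeze (i : Fin 3) : Continuous fun θ : ℝ => squeeze i (θ : ℂ) := by
  refine continuous_clm_apply.2 fun q => continuous_pi fun j => ?_
  simp only [squeeze_apply]
  split_ifs <;> fun_prop

theorem hasDerivAt_squeeze (i : Fin 3) (q : C3) (θ : ℝ) :
    HasDerivAt (fun θ : ℝ => squeeze i (θ : ℂ) q) (q i • Pi.single i (1 : ℂ)) θ := by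
  rw [hasDerivAt_pi]
  intro j
  simp only [squeeze_apply]
  by_cases h : j = i
  · subst h
    simpa using (Complex.ofRealCLM.hasDerivAt (x := θ)).mul_const (q j)
  · simpa [h] using hasDerivAt_const θ (q j)

/-- Integration of `k` in the direction of the `i`-th coordinate. -/
noncomputable def primitive (i : Fin 3) (k : C3 → ℂ) (q : C3) : ℂ :=
  q i * ∫ θ in (0 : ℝ)..1, k (squeeze i θ q)

variable {i : Fin 3} {k : C3 → ℂ} {r M : ℝ}

theorem continuousOn_comp_squeeze {F : Type*} [TopologicalSpace F] {k : C3 → F}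
    (hk : ContinuousOn k (ball 0 r)) {q : C3} (hq : q ∈ ball (0 : C3) r) :
    ContinuousOn (fun θ : ℝ => k (squeeze i θ q)) (Icc 0 1) :=
  hk.comp ((continuous_squeeze i).clm_apply continuous_const).continuousOn
    fun _ hθ => squeeze_mem_ball i hθ hq

theorem intervalIntegrable_comp_squeeze {F : Type*} [NormedAddCommGroup F] {k : C3 → F}
    (hk : ContinuousOn k (ball 0 r)) {q : C3} (hq : q ∈ ball (0 : C3) r) :
    IntervalIntegrable (fun θ : ℝ => k (squeeze i θ q)) MeasureTheory.volume 0 1 :=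
  ContinuousOn.intervalIntegrable (by
    rw [uIcc_of_le zero_le_one]; exact continuousOn_comp_squeeze hk hq)

theorem continuousOn_fderiv (hk : DifferentiableOn ℂ k (ball 0 r)) :
    ContinuousOn (fderiv ℂ k) (ball 0 r) := fun x hx => by
  have h : ∀ᶠ y in 𝓝 x, DifferentiableAt ℂ k y :=
    Filter.mem_of_superset (isOpen_ball.mem_nhds hx) fun y hy => hk.differentiableAt (isOpen_ball.mem_nhds hy)
  exact (eventually_differentiableAt_fderiv h).self_of_nhds.continuousAt.continuousWithinAt

/-- Differentiation under the integral sign; the Cauchy estimate supplies a constant dominating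
bound. -/
theorem hasFDerivAt_integral_squeeze (hk : DifferentiableOn ℂ k (ball 0 r))
    (hM : ∀ q ∈ ball (0 : C3) r, ‖k q‖ ≤ M) {q : C3} (hq : q ∈ ball (0 : C3) r) :
    HasFDerivAt (fun q => ∫ θ in (0 : ℝ)..1, k (squeeze i θ q))
      (∫ θ in (0 : ℝ)..1, (fderiv ℂ k (squeeze i θ q)).comp (squeeze i θ)) q := by
  -- Half the distance to the sphere: for x within η of q, the η-ball about each squeezed point of x
  -- still lies in the ball of radius r.
  have hq' := mem_ball_zero_iff.1 hq
  set η := (r - ‖q‖) / 2 with hη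
  have hη0 : 0 < η := by rw [hη]; linarith
  have hM0 : 0 ≤ M := (norm_nonneg _).trans (hM q hq)
  have hIoc : uIoc (0 : ℝ) 1 ⊆ Icc 0 1 := by
    rw [uIoc_of_le zero_le_one]; exact Ioc_subset_Icc_self
  have hball : ∀ x ∈ ball q η, ‖x‖ + η < r := fun x hx => by
    have := norm_le_norm_add_norm_sub' x q
    rw [mem_ball, dist_eq_norm] at hx
    linarith [norm_sub_rev q x]
  have hball' : ∀ x ∈ ball q η, x ∈ ball (0 : C3) r := fun x hx => by
    rw [mem_ball_zero_iff]; linarith [hball x hx]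
  refine intervalIntegral.hasFDerivAt_integral_of_dominated_of_fderiv_le
    (F := fun x (θ : ℝ) => k (squeeze i θ x))
    (F' := fun x (θ : ℝ) => (fderiv ℂ k (squeeze i θ x)).comp (squeeze i θ))
    (s := ball q η) (bound := fun _ => 2 * M / η) (ball_mem_nhds q hη0) ?_ ?_ ?_ ?_ ?_ ?_
  · filter_upwards [isOpen_ball.mem_nhds hq] with x hx
    exact ((continuousOn_comp_squeeze hk.continuousOn hx).mono hIoc).aestronglyMeasurable
      measurableSet_uIoc
  · exact intervalIntegrable_comp_squeeze hk.continuousOn hq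
  · refine ContinuousOn.aestronglyMeasurable ?_ measurableSet_uIoc
    exact ((continuousOn_comp_squeeze (continuousOn_fderiv hk) hq).mono hIoc).clm_comp
      (continuous_squeeze i).continuousOn
  · refine Eventually.of_forall fun θ hθ x hx => ?_
    have h1 : ‖fderiv ℂ k (squeeze i θ x)‖ ≤ 2 * M / η := by
      have hsub : ball (squeeze i (θ : ℂ) x) η ⊆ ball 0 r := by
        refine ball_subset_ball' ?_
        rw [dist_zero_right]
        linarith [norm_squeeze_apply_le i (hIoc hθ) x, hball x hx]
      exact norm_fderiv_le_of_bound hη0 (hk.mono hsub) fun z hz => hM z (hsub hz)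
    calc _ ≤ ‖fderiv ℂ k (squeeze i θ x)‖ * ‖squeeze i (θ : ℂ)‖ :=
          ContinuousLinearMap.opNorm_comp_le _ _
      _ ≤ 2 * M / η * 1 := by
          gcongr
          exact norm_squeeze_le i (hIoc hθ)
      _ = 2 * M / η := mul_one _
  · exact intervalIntegrable_const
  · refine Eventually.of_forall fun θ hθ x hx => ?_
    have := (hk.differentiableAt (isOpen_ball.mem_nhds
      (squeeze_mem_ball i (hIoc hθ) (hball' x hx)))).hasFDerivAt
    exact this.comp x (squeeze i (θ : ℂ)).hasFDerivAt

theorem hasFDerivAt_primitive (hk : DifferentiableOn ℂ k (ball 0 r))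
    (hM : ∀ q ∈ ball (0 : C3) r, ‖k q‖ ≤ M) {q : C3} (hq : q ∈ ball (0 : C3) r) :
    ∃ L : C3 →L[ℂ] ℂ, HasFDerivAt (primitive i k) L q ∧ L (Pi.single i 1) = k q := by
  have h1 := hasFDerivAt_integral_squeeze (i := i) hk hM hq
  have h2 : HasFDerivAt (fun q : C3 => q i) (ContinuousLinearMap.proj (R := ℂ) i) q :=
    (ContinuousLinearMap.proj (R := ℂ) (φ := fun _ : Fin 3 => ℂ) i).hasFDerivAt
  refine ⟨_, h2.mul h1, ?_⟩
  have hc : ContinuousOn (fun θ : ℝ => (fderiv ℂ k (squeeze i θ q)).comp (squeeze i θ))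
      (Icc 0 1) := (continuousOn_comp_squeeze (continuousOn_fderiv hk) hq).clm_comp
      (continuous_squeeze i).continuousOn
  have hint : IntervalIntegrable
      (fun θ : ℝ => (fderiv ℂ k (squeeze i θ q)).comp (squeeze i θ)) MeasureTheory.volume 0 1 :=
    ContinuousOn.intervalIntegrable (by rwa [uIcc_of_le zero_le_one])
  have happ := ContinuousLinearMap.intervalIntegral_apply hint (Pi.single i (1 : ℂ))
  have hint' : IntervalIntegrable (fun θ : ℝ => ((fderiv ℂ k (squeeze i θ q)).comp
      (squeeze i θ)) (Pi.single i (1 : ℂ))) MeasureTheory.volume 0 1 :=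
    ContinuousOn.intervalIntegrable (by
      rw [uIcc_of_le zero_le_one]; exact hc.clm_apply continuousOn_const)
  simp only [add_apply, smul_apply, happ,
    ContinuousLinearMap.proj_apply, Pi.single_eq_same, smul_eq_mul, mul_one]
  rw [← intervalIntegral.integral_const_mul, ← intervalIntegral.integral_add
    (hint'.const_mul _) (intervalIntegrable_comp_squeeze hk.continuousOn hq)]
  -- The product rule turns the integrand into the θ-derivative of θ k(squeeze θ q), so the integral
  -- telescopes to k q.
  have hder : ∀ θ ∈ uIcc (0 : ℝ) 1, HasDerivAt (fun θ : ℝ => (θ : ℂ) * k (squeeze i θ q))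
      (q i * ((fderiv ℂ k (squeeze i θ q)).comp (squeeze i θ)) (Pi.single i (1 : ℂ))
        + k (squeeze i θ q)) θ := by
    intro θ hθ
    rw [uIcc_of_le zero_le_one] at hθ
    have hkd := (hk.differentiableAt (isOpen_ball.mem_nhds
      (squeeze_mem_ball i hθ hq))).hasFDerivAt.restrictScalars ℝ
    have hd := (Complex.ofRealCLM.hasDerivAt (x := θ)).mul
      (hkd.comp_hasDerivAt θ (hasDerivAt_squeeze i q θ))
    refine hd.congr_deriv ?_
    simp only [ContinuousLinearMap.comp_apply, squeeze_single, map_smul, smul_eq_mul,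
      ContinuousLinearMap.coe_restrictScalars', Complex.ofRealCLM_apply, Complex.ofReal_one,
      Function.comp_apply]
    ring
  rw [intervalIntegral.integral_eq_sub_of_hasDerivAt hder]
  · simp [squeeze_one]
  · exact (hint'.const_mul _).add (intervalIntegrable_comp_squeeze hk.continuousOn hq)

theorem norm_primitive_le (hM : ∀ q ∈ ball (0 : C3) r, ‖k q‖ ≤ M) {q : C3}
    (hq : q ∈ ball (0 : C3) r) : ‖primitive i k q‖ ≤ r * M := by
  have h1 : ‖∫ θ in (0 : ℝ)..1, k (squeeze i θ q)‖ ≤ M * |(1 : ℝ) - 0| :=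
    intervalIntegral.norm_integral_le_of_norm_le_const fun θ hθ => by
      rw [uIoc_of_le zero_le_one] at hθ
      exact hM _ (squeeze_mem_ball i (Ioc_subset_Icc_self hθ) hq)
  rw [sub_zero, abs_one, mul_one] at h1
  have h2 := mem_ball_zero_iff.1 hq
  rw [primitive, norm_mul]
  exact mul_le_mul ((norm_le_pi_norm q i).trans h2.le) h1 (norm_nonneg _)
    ((norm_nonneg q).trans h2.le)

theorem primitive_sub {k₁ k₂ : C3 → ℂ} (h₁ : ContinuousOn k₁ (ball 0 r))
    (h₂ : ContinuousOn k₂ (ball 0 r)) {q : C3} (hq : q ∈ ball (0 : C3) r) :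
    primitive i k₁ q - primitive i k₂ q = primitive i (fun q => k₁ q - k₂ q) q := by
  rw [primitive, primitive, primitive, intervalIntegral.integral_sub
    (intervalIntegrable_comp_squeeze h₁ hq) (intervalIntegrable_comp_squeeze h₂ hq), mul_sub]

end Flow

/-! ### Picard iteration with holomorphic parameters. -/

section Flow

variable {i : Fin 3} {g : C3 → ℂ} {R r M : ℝ}

/-- Replacement of the last coordinate by the value of a function. -/
noncomputable def shear (Z : C3 → ℂ) (q : C3) : C3 := ![q 0, q 1, Z q]

theorem shear_mem_ball {Z : C3 → ℂ} {q : C3} (hq : q ∈ ball (0 : C3) r) (hr : r ≤ R)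
    (hZ : ‖Z q‖ < R) : shear Z q ∈ ball (0 : C3) R := by
  rw [mem_ball_zero_iff] at hq ⊢
  have hR : 0 < R := (norm_nonneg _).trans_lt hZ
  refine (pi_norm_lt_iff hR).2 fun j => ?_
  fin_cases j
  · exact ((norm_le_pi_norm q 0).trans_lt hq).trans_le hr
  · exact ((norm_le_pi_norm q 1).trans_lt hq).trans_le hr
  · exact hZ

theorem differentiableAt_shear {Z : C3 → ℂ} {q : C3} (hZ : DifferentiableAt ℂ Z q) :
    DifferentiableAt ℂ (shear Z) q := by
  refine differentiableAt_pi.2 fun j => ?_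
  fin_cases j
  · exact differentiableAt_apply (𝕜 := ℂ) 0 q
  · exact differentiableAt_apply (𝕜 := ℂ) 1 q
  · exact hZ

theorem norm_shear_sub (Z W : C3 → ℂ) (q : C3) : ‖shear Z q - shear W q‖ ≤ ‖Z q - W q‖ := by
  refine (pi_norm_le_iff_of_nonneg (norm_nonneg _)).2 fun j => ?_
  fin_cases j <;> simp [shear]

/-- Picard iteration for the equation `∂ᵢ Z = g (x, y, Z)` with `Z = z` where the `i`-th
coordinate vanishes. -/
noncomputable def picard (i : Fin 3) (g : C3 → ℂ) : ℕ → C3 → ℂ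
  | 0 => fun q => q 2
  | n + 1 => fun q => q 2 + primitive i (fun p => g (shear (picard i g n) p)) q

/-- The condition r + r M < R keeps the sheared points inside the ball where g is controlled, so the
iteration never leaves its domain. -/
theorem picard_bound (hg : DifferentiableOn ℂ g (ball 0 R)) (hM : ∀ q ∈ ball (0 : C3) R, ‖g q‖ ≤ M)
    (hM0 : 0 ≤ M) (hr0 : 0 < r) (hr : r + r * M < R) (n : ℕ) :
    DifferentiableOn ℂ (picard i g n) (ball 0 r) ∧
      ∀ q ∈ ball (0 : C3) r, ‖picard i g n q‖ ≤ r + r * M := by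
  have hrM : 0 ≤ r * M := by positivity
  induction n with
  | zero =>
    refine ⟨(differentiable_apply (𝕜 := ℂ) (2 : Fin 3)).differentiableOn, fun q hq => ?_⟩
    have := norm_le_pi_norm q 2
    rw [mem_ball_zero_iff] at hq
    simp only [picard]
    linarith
  | succ n ih =>
    obtain ⟨h1, h2⟩ := ih
    have hmem : ∀ q ∈ ball (0 : C3) r, shear (picard i g n) q ∈ ball (0 : C3) R := fun q hq =>
      shear_mem_ball hq (by linarith) ((h2 q hq).trans_lt hr)
    have hk : DifferentiableOn ℂ (fun p => g (shear (picard i g n) p)) (ball 0 r) :=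
      hg.comp (fun q hq => (differentiableAt_shear (h1.differentiableAt
        (isOpen_ball.mem_nhds hq))).differentiableWithinAt) hmem
    have hkM : ∀ q ∈ ball (0 : C3) r, ‖g (shear (picard i g n) q)‖ ≤ M := fun q hq =>
      hM _ (hmem q hq)
    constructor
    · refine (differentiable_apply (𝕜 := ℂ) (2 : Fin 3)).differentiableOn.add fun q hq => ?_
      obtain ⟨L, hL, -⟩ := hasFDerivAt_primitive (i := i) hk hkM hq
      exact hL.differentiableAt.differentiableWithinAt
    · intro q hq
      have h3 := norm_primitive_le (i := i) hkM hq
      have h4 := norm_le_pi_norm q 2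
      rw [mem_ball_zero_iff] at hq
      simp only [picard]
      refine (norm_add_le _ _).trans ?_
      linarith

/-- Local solution, holomorphic in the variable and the parameters, of the equation
`∂ᵢ Z = g (x, y, Z)` with `Z = z` where the `i`-th coordinate vanishes. -/
theorem exists_flow (i : Fin 3) {g : C3 → ℂ} (hg : ContDiffAt ℂ 1 g 0) :
    ∃ Z : C3 → ℂ, ContDiffAt ℂ 1 Z 0 ∧
      (∀ᶠ q in 𝓝 0, fderiv ℂ Z q (Pi.single i 1) = (if i = 2 then 1 else 0) + g (shear Z q)) ∧
      ∀ q, q i = 0 → Z q = q 2 := by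
  obtain ⟨R, M, hR, hM0, hgd, hM⟩ : ∃ R M : ℝ, 0 < R ∧ 0 ≤ M ∧
      DifferentiableOn ℂ g (ball 0 (R + R)) ∧ ∀ q ∈ ball (0 : C3) (R + R), ‖g q‖ ≤ M := by
    have hb : ∀ᶠ x in 𝓝 (0 : C3), ‖g x‖ < ‖g 0‖ + 1 :=
      hg.continuousAt.norm.eventually (gt_mem_nhds (lt_add_one _))
    obtain ⟨R, hR, h⟩ := Metric.eventually_nhds_iff_ball.1 ((eventually_differentiableAt hg).and hb)
    refine ⟨R / 2, ‖g 0‖ + 1, by positivity, by positivity, ?_, ?_⟩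
    · rw [add_halves]; exact fun x hx => (h x hx).1.differentiableWithinAt
    · rw [add_halves]; exact fun x hx => (h x hx).2.le
  have hRR : ball (0 : C3) R ⊆ ball 0 (R + R) := ball_subset_ball (by linarith)
  set K : ℝ := 2 * M / R with hK
  have hK0 : 0 ≤ K := by positivity
  have hlip : ∀ x ∈ ball (0 : C3) R, ∀ y ∈ ball (0 : C3) R, ‖g y - g x‖ ≤ K * ‖y - x‖ := by
    intro x hx y hy
    refine (convex_ball (0 : C3) R).norm_image_sub_le_of_norm_fderiv_le (𝕜 := ℂ) (f := g)
      (fun z hz => hgd.differentiableAt (isOpen_ball.mem_nhds (hRR hz))) (fun z hz => ?_) hx hy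
    have hsub : ball z R ⊆ ball 0 (R + R) := ball_subset_ball' (by
      rw [mem_ball] at hz; linarith)
    exact norm_fderiv_le_of_bound hR (hgd.mono hsub) fun w hw => hM w (hsub hw)
  replace hgd := hgd.mono hRR
  replace hM : ∀ q ∈ ball (0 : C3) R, ‖g q‖ ≤ M := fun q hq => hM q (hRR hq)
  -- The first bound on r keeps the iterates in the domain of g; the second makes the iteration a
  -- contraction with factor 1/2.
  obtain ⟨r, hr0, hr, hrK⟩ : ∃ r : ℝ, 0 < r ∧ r + r * M < R ∧ r * K ≤ 1 / 2 := by
    refine ⟨min (R / (2 * (1 + M))) (1 / (2 * (K + 1))), by positivity, ?_, ?_⟩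
    · have h1 : min (R / (2 * (1 + M))) (1 / (2 * (K + 1))) ≤ R / (2 * (1 + M)) := min_le_left _ _
      have h2 : R / (2 * (1 + M)) * (1 + M) = R / 2 := by field_simp
      nlinarith
    · have h1 : min (R / (2 * (1 + M))) (1 / (2 * (K + 1))) ≤ 1 / (2 * (K + 1)) := min_le_right _ _
      have h2 : 1 / (2 * (K + 1)) * (K + 1) = 1 / 2 := by field_simp
      have h3 : 0 < 1 / (2 * (K + 1)) := by positivity
      nlinarith
  have hrM : 0 ≤ r * M := by positivity
  set P := picard i g with hP
  have hPd : ∀ n, DifferentiableOn ℂ (P n) (ball 0 r) := fun n =>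
    (picard_bound hgd hM hM0 hr0 hr n).1
  have hPb : ∀ n, ∀ q ∈ ball (0 : C3) r, ‖P n q‖ ≤ r + r * M := fun n =>
    (picard_bound hgd hM hM0 hr0 hr n).2
  have hcomp : ∀ Z : C3 → ℂ, DifferentiableOn ℂ Z (ball 0 r) →
      (∀ q ∈ ball (0 : C3) r, ‖Z q‖ ≤ r + r * M) →
      DifferentiableOn ℂ (fun q => g (shear Z q)) (ball 0 r) ∧
      ∀ q ∈ ball (0 : C3) r, ‖g (shear Z q)‖ ≤ M := fun Z hZ hZb => by
    have hmem : ∀ q ∈ ball (0 : C3) r, shear Z q ∈ ball (0 : C3) R := fun q hq =>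
      shear_mem_ball hq (by linarith) ((hZb q hq).trans_lt hr)
    exact ⟨hgd.comp (fun q hq => (differentiableAt_shear (hZ.differentiableAt
      (isOpen_ball.mem_nhds hq))).differentiableWithinAt) hmem, fun q hq => hM _ (hmem q hq)⟩
  have hcontr : ∀ Z W : C3 → ℂ, DifferentiableOn ℂ Z (ball 0 r) →
      DifferentiableOn ℂ W (ball 0 r) → (∀ q ∈ ball (0 : C3) r, ‖Z q‖ ≤ r + r * M) →
      (∀ q ∈ ball (0 : C3) r, ‖W q‖ ≤ r + r * M) → ∀ ε, (∀ q ∈ ball (0 : C3) r, ‖Z q - W q‖ ≤ ε) →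
      ∀ q ∈ ball (0 : C3) r, ‖primitive i (fun q => g (shear Z q)) q -
        primitive i (fun q => g (shear W q)) q‖ ≤ ε / 2 := by
    intro Z W hZ hW hZb hWb ε hε q hq
    have hε0 : 0 ≤ ε := (norm_nonneg _).trans (hε q hq)
    rw [primitive_sub (hcomp Z hZ hZb).1.continuousOn (hcomp W hW hWb).1.continuousOn hq]
    have := norm_primitive_le (i := i) (k := fun q => g (shear Z q) - g (shear W q))
      (M := K * ε) (fun p hp => ?_) hq
    · nlinarith
    · refine (hlip _ (shear_mem_ball hp (by linarith) ((hWb p hp).trans_lt hr)) _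
        (shear_mem_ball hp (by linarith) ((hZb p hp).trans_lt hr))).trans ?_
      exact mul_le_mul_of_nonneg_left ((norm_shear_sub Z W p).trans (hε p hp)) hK0
  -- Initial gap: both iterates are bounded by r + r M < R, so they differ by at most 2R, written in
  -- the form the geometric-series lemma expects.
  have hgeom : ∀ n, ∀ q ∈ ball (0 : C3) r, dist (P n q) (P (n + 1) q) ≤ 4 * R / 2 / 2 ^ n := by
    intro n
    induction n with
    | zero =>
      intro q hq
      rw [dist_eq_norm]
      refine (norm_sub_le _ _).trans ?_
      simp only [pow_zero]
      linarith [hPb 0 q hq, hPb 1 q hq]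
    | succ n ih =>
      intro q hq
      have := hcontr (P n) (P (n + 1)) (hPd _) (hPd _) (hPb _) (hPb _) _
        (fun q hq => by rw [← dist_eq_norm]; exact ih q hq) q hq
      rw [dist_eq_norm, pow_succ, ← div_div]
      refine le_trans (le_of_eq ?_) this
      simp only [hP, picard, add_sub_add_left_eq_sub]
  have hlim : ∀ q ∈ ball (0 : C3) r, ∃ z, Tendsto (fun n => P n q) atTop (𝓝 z) := fun q hq =>
    cauchySeq_tendsto_of_complete (cauchySeq_of_le_geometric_two (fun n => hgeom n q hq))
  choose! Z₀ hZ₀ using hlim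
  have hdist : ∀ n, ∀ q ∈ ball (0 : C3) r, dist (P n q) (Z₀ q) ≤ 4 * R / 2 ^ n := fun n q hq =>
    dist_le_of_le_geometric_two_of_tendsto (fun n => hgeom n q hq) (hZ₀ q hq) n
  have hpow : Tendsto (fun n : ℕ => 4 * R / 2 ^ n) atTop (𝓝 0) :=
    tendsto_const_nhds.div_atTop (tendsto_pow_atTop_atTop_of_one_lt one_lt_two)
  have hunif : TendstoUniformlyOn P Z₀ atTop (ball 0 r) := by
    rw [Metric.tendstoUniformlyOn_iff]
    intro ε hε
    filter_upwards [hpow.eventually (gt_mem_nhds hε)] with n hn q hq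
    rw [dist_comm]
    exact (hdist n q hq).trans_lt hn
  have hZd : DifferentiableOn ℂ Z₀ (ball 0 r) := differentiableOn_of_tendstoUniformlyOn hPd hunif
  have hZb : ∀ q ∈ ball (0 : C3) r, ‖Z₀ q‖ ≤ r + r * M := fun q hq =>
    le_of_tendsto (hZ₀ q hq).norm (Eventually.of_forall fun n => hPb n q hq)
  have hfix : ∀ q ∈ ball (0 : C3) r, Z₀ q = q 2 + primitive i (fun p => g (shear Z₀ p)) q := by
    intro q hq
    refine tendsto_nhds_unique ((tendsto_add_atTop_iff_nat 1).2 (hZ₀ q hq)) ?_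
    rw [tendsto_iff_norm_sub_tendsto_zero]
    refine squeeze_zero (fun _ => norm_nonneg _) (fun n => ?_) (by simpa using hpow.div_const 2)
    have := hcontr (P n) Z₀ (hPd _) hZd (hPb _) hZb _
      (fun q hq => by rw [← dist_eq_norm]; exact hdist n q hq) q hq
    refine le_trans (le_of_eq ?_) this
    simp only [hP, picard, add_sub_add_left_eq_sub]
  obtain ⟨hkd, hkM⟩ := hcomp Z₀ hZd hZb
  have hev : ∀ᶠ q in 𝓝 (0 : C3), q ∈ ball (0 : C3) r := ball_mem_nhds 0 hr0
  -- The limit Z₀ is controlled only on the ball. The right-hand side of the fixed-point equation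
  -- agrees with it there and satisfies the initial condition at every point.
  set Z : C3 → ℂ := fun q => q 2 + primitive i (fun p => g (shear Z₀ p)) q with hZ
  refine ⟨Z, contDiffAt_one_of_eventually ?_, ?_, fun q hq => by simp [hZ, primitive, hq]⟩
  · filter_upwards [hev] with q hq
    obtain ⟨L, hL, -⟩ := hasFDerivAt_primitive (i := i) hkd hkM hq
    exact (differentiableAt_apply (𝕜 := ℂ) (2 : Fin 3) q).add hL.differentiableAt
  · filter_upwards [hev] with q hq
    obtain ⟨L, hL, hL'⟩ := hasFDerivAt_primitive (i := i) hkd hkM hq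
    have h2 : HasFDerivAt (fun q : C3 => q 2) (ContinuousLinearMap.proj (R := ℂ) 2) q :=
      (ContinuousLinearMap.proj (R := ℂ) (φ := fun _ : Fin 3 => ℂ) 2).hasFDerivAt
    have h3 : HasFDerivAt Z (_ + L) q := h2.add hL
    rw [h3.fderiv, add_apply, hL', ContinuousLinearMap.proj_apply]
    congr 1
    · simp [Pi.single_apply, eq_comm]
    · have h4 : Z q = Z₀ q := (hfix q hq).symm
      simp only [shear, h4]

end Flow

/-! ### Local normal forms of the distribution. -/

section LocalModels

variable {Δ : PlaneField} {p : C3}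

theorem isInvertible_of_injective {L : C3 →L[ℂ] C3} (h : ∀ v, L v = 0 → v = 0) :
    L.IsInvertible := by
  have hinj : Function.Injective (L : C3 →ₗ[ℂ] C3) := (injective_iff_map_eq_zero _).2 h
  refine ⟨(LinearEquiv.ofInjectiveEndo (L : C3 →ₗ[ℂ] C3) hinj).toContinuousLinearEquiv, ?_⟩
  ext v
  rfl

theorem eventually_isInvertible {G : C3 → C3} {c : C3} (hG : ContDiffAt ℂ 1 G c)
    (h : (fderiv ℂ G c).IsInvertible) : ∀ᶠ q in 𝓝 c, (fderiv ℂ G q).IsInvertible := by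
  obtain ⟨e, he⟩ := h
  have hc : ContinuousAt (fderiv ℂ G) c := (contDiffAt_one_fderiv hG).continuousAt
  exact hc.eventually (by rw [← he]; exact e.nhds)

/-- Near `p` the distribution is, in suitable holomorphic coordinates centred at `p`, the field of
zero sets of `l`. -/
def LocalModel (Δ : PlaneField) (p : C3) (l : C3 → C3 → ℂ) : Prop :=
  ∃ G : C3 → C3, ContDiffAt ℂ 1 G 0 ∧ G 0 = p ∧ (fderiv ℂ G 0).IsInvertible ∧
    ∀ᶠ q in 𝓝 0, ∀ v, fderiv ℂ G q v ∈ Δ (G q) ↔ l q v = 0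

/-- Pullback by the chain rule. Only zero sets are compared, so nonvanishing factors may be
discarded after each change of coordinates. -/
theorem LocalModel.comp {l m : C3 → C3 → ℂ} (h : LocalModel Δ p l) {H : C3 → C3}
    (hH : ContDiffAt ℂ 1 H 0) (hH0 : H 0 = 0) (hinv : (fderiv ℂ H 0).IsInvertible)
    (hm : ∀ᶠ q in 𝓝 0, ∀ v, l (H q) (fderiv ℂ H q v) = 0 ↔ m q v = 0) : LocalModel Δ p m := by
  obtain ⟨G, hG, hG0, hGinv, hGl⟩ := h
  have hG' : ContDiffAt ℂ 1 G (H 0) := by rwa [hH0]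
  have htend : Tendsto H (𝓝 0) (𝓝 0) := by
    have := hH.continuousAt.tendsto; rwa [hH0] at this
  refine ⟨G ∘ H, hG'.comp 0 hH, by rw [Function.comp_apply, hH0, hG0], ?_, ?_⟩
  · rw [fderiv_comp 0 (hG'.differentiableAt (by simp)) (hH.differentiableAt (by simp)), hH0]
    exact hGinv.comp hinv
  · filter_upwards [hm, htend.eventually hGl, eventually_differentiableAt hH,
      htend.eventually (eventually_differentiableAt hG)] with q h1 h2 h3 h4 v
    rw [fderiv_comp q h4 h3]
    exact (h2 _).trans (h1 v)

theorem tendsto_add_left_zero (a : C3) : Tendsto (fun q : C3 => a + q) (𝓝 0) (𝓝 a) := by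
  have : Continuous fun q : C3 => a + q := by fun_prop
  simpa using this.tendsto 0

/-- Lets a normal form found at p be used at nearby points, where the contact condition may hold
even if it fails at p. -/
theorem LocalModel.recenter {l : C3 → C3 → ℂ} (h : LocalModel Δ p l) :
    ∀ᶠ a in 𝓝 (0 : C3), ∃ p', LocalModel Δ p' fun q => l (a + q) := by
  obtain ⟨G, hG, -, hGinv, hGl⟩ := h
  filter_upwards [hG.eventually (by simp), eventually_isInvertible hG hGinv,
    hGl.eventually_nhds] with a h1 h2 h3
  refine ⟨G a, fun q => G (a + q), ?_, by simp, ?_, ?_⟩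
  · refine ContDiffAt.comp (g := G) (f := fun q => a + q) 0 (by simpa using h1) (by fun_prop)
  · rw [fderiv_comp_add_left]; simpa using h2
  · filter_upwards [(tendsto_add_left_zero a).eventually h3] with q hq
    rw [fderiv_comp_add_left]; exact hq

theorem clm_apply_eq (L : C3 →L[ℂ] ℂ) (v : C3) :
    L v = L (Pi.single 0 1) * v 0 + L (Pi.single 1 1) * v 1 + L (Pi.single 2 1) * v 2 := by
  have hv : v = v 0 • Pi.single 0 1 + v 1 • Pi.single 1 1 + v 2 • (Pi.single 2 1 : C3) := by
    ext j; fin_cases j <;> simp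
  conv_lhs => rw [hv]
  simp only [map_add, map_smul, smul_eq_mul]
  ring

/-- Permutation of coordinates exchanging the last one and the `j`-th. -/
noncomputable def swapLast (j : Fin 3) : C3 →L[ℂ] C3 :=
  ContinuousLinearMap.pi fun k => ContinuousLinearMap.proj (Equiv.swap j 2 k)

theorem swapLast_apply (j : Fin 3) (v : C3) (k : Fin 3) :
    swapLast j v k = v (Equiv.swap j 2 k) := rfl

theorem isInvertible_swapLast (j : Fin 3) : (swapLast j).IsInvertible :=
  isInvertible_of_injective fun v hv => by
    ext k
    have := congrFun hv (Equiv.swap j 2 k)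
    rwa [swapLast_apply, Equiv.swap_apply_self] at this

theorem swapLast_single (j : Fin 3) : swapLast j (Pi.single 2 1) = Pi.single j 1 := by
  ext k
  simp only [swapLast_apply, Pi.single_apply]
  congr 1
  rw [Equiv.swap_apply_eq_iff, Equiv.swap_apply_right]

/-- Every holomorphic plane distribution is locally the kernel of `a dx + b dy + dz`. -/
theorem exists_localModel_graph (hΔ : IsHolomorphicHyperplaneDistribution Δ) (p : C3) :
    ∃ a b : C3 → ℂ, ContDiffAt ℂ 1 a 0 ∧ ContDiffAt ℂ 1 b 0 ∧
      LocalModel Δ p fun q v => a q * v 0 + b q * v 1 + v 2 := by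
  obtain ⟨U, hU, hpU, ω, hω⟩ := hΔ p
  obtain ⟨j, hj⟩ : ∃ j, ω p (Pi.single j 1) ≠ 0 := by
    by_contra! h
    exact hω.ne_zero p hpU (by ext v; rw [clm_apply_eq]; simp [h])
  set G : C3 → C3 := fun q => p + swapLast j q with hG
  have hG0 : G 0 = p := by simp [hG]
  have hGd : ∀ q, HasFDerivAt G (swapLast j) q := fun q => (swapLast j).hasFDerivAt.const_add p
  have hGc : ContDiff ℂ 1 G := contDiff_const.add (swapLast j).contDiff
  have hωp : ContDiffAt ℂ 1 ω (G 0) := by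
    rw [hG0]
    exact contDiffAt_one_of_eventually (Filter.mem_of_superset (hU.mem_nhds hpU) fun x hx =>
      hω.holomorphic.differentiableAt (hU.mem_nhds hx))
  set c : Fin 3 → C3 → ℂ := fun k q => ω (G q) (swapLast j (Pi.single k 1)) with hc
  have hcd : ∀ k, ContDiffAt ℂ 1 (c k) 0 := fun k =>
    (hωp.comp 0 hGc.contDiffAt).clm_apply contDiffAt_const
  have hc2 : c 2 0 ≠ 0 := by simp only [hc, hG0, swapLast_single]; exact hj
  refine ⟨fun q => c 0 q / c 2 q, fun q => c 1 q / c 2 q, (hcd 0).div (hcd 2) hc2,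
    (hcd 1).div (hcd 2) hc2, G, hGc.contDiffAt, hG0, ?_, ?_⟩
  · rw [(hGd 0).fderiv]; exact isInvertible_swapLast j
  · filter_upwards [(hcd 2).continuousAt.eventually_ne hc2,
      hGc.continuous.continuousAt.eventually (by rw [hG0]; exact hU.mem_nhds hpU)] with q h1 h2 v
    rw [hω.mem_iff _ h2, (hGd q).fderiv]
    have : ω (G q) (swapLast j v) = c 2 q * (c 0 q / c 2 q * v 0 + c 1 q / c 2 q * v 1 + v 2) := by
      have := clm_apply_eq ((ω (G q)).comp (swapLast j)) v
      simp only [ContinuousLinearMap.comp_apply] at this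
      rw [this]
      simp only [hc] at h1 ⊢
      field_simp
    rw [this, mul_eq_zero, or_iff_right h1]

theorem contDiffAt_shear {Z : C3 → ℂ} {c : C3} (hZ : ContDiffAt ℂ 1 Z c) :
    ContDiffAt ℂ 1 (shear Z) c :=
  contDiffAt_one_of_eventually
    ((eventually_differentiableAt hZ).mono fun _ h => differentiableAt_shear h)

theorem fderiv_shear {Z : C3 → ℂ} {q : C3} (hZ : DifferentiableAt ℂ Z q) (v : C3) :
    fderiv ℂ (shear Z) q v = ![v 0, v 1, fderiv ℂ Z q v] := by
  have h : HasFDerivAt (shear Z) (ContinuousLinearMap.pi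
      ![ContinuousLinearMap.proj 0, ContinuousLinearMap.proj 1, fderiv ℂ Z q]) q := by
    refine hasFDerivAt_pi.2 fun j => ?_
    fin_cases j
    · exact hasFDerivAt_apply (𝕜 := ℂ) 0 q
    · exact hasFDerivAt_apply (𝕜 := ℂ) 1 q
    · exact hZ.hasFDerivAt
  rw [h.fderiv]
  ext j
  fin_cases j <;> rfl

theorem isInvertible_fderiv_shear {Z : C3 → ℂ} {q : C3} (hZ : DifferentiableAt ℂ Z q)
    (h2 : fderiv ℂ Z q (Pi.single 2 1) ≠ 0) : (fderiv ℂ (shear Z) q).IsInvertible := by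
  refine isInvertible_of_injective fun v hv => ?_
  rw [fderiv_shear hZ] at hv
  have h0 : v 0 = 0 := congrFun hv 0
  have h1 : v 1 = 0 := congrFun hv 1
  have h3 : fderiv ℂ Z q v = 0 := congrFun hv 2
  rw [clm_apply_eq, h0, h1] at h3
  have h4 : v 2 = 0 := by simpa [h2] using h3
  ext j
  fin_cases j <;> assumption

theorem shear_zero {Z : C3 → ℂ} (h : Z 0 = 0) : shear Z 0 = 0 := by
  ext j; fin_cases j <;> simp [shear, h]

theorem fderiv_single_two_of_eq {Z : C3 → ℂ} (hZ : DifferentiableAt ℂ Z 0)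
    (h : ∀ t : ℂ, Z (t • Pi.single 2 1) = t) : fderiv ℂ Z 0 (Pi.single 2 1) = 1 := by
  have hl : HasDerivAt (fun t : ℂ => t • (Pi.single 2 1 : C3)) (Pi.single 2 1) 0 := by
    simpa using (hasDerivAt_id (0 : ℂ)).smul_const (Pi.single 2 1 : C3)
  have hZ' : HasFDerivAt Z (fderiv ℂ Z 0) ((0 : ℂ) • (Pi.single 2 1 : C3)) := by
    rw [zero_smul]; exact hZ.hasFDerivAt
  have h1 := hZ'.comp_hasDerivAt (0 : ℂ) hl
  have h2 : (Z ∘ fun t : ℂ => t • (Pi.single 2 1 : C3)) = fun t => t := funext h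
  rw [h2] at h1
  exact h1.unique (hasDerivAt_id 0)

/-- Every holomorphic plane distribution is locally the kernel of `dz - f dx`. -/
theorem exists_localModel_slope (hΔ : IsHolomorphicHyperplaneDistribution Δ) (p : C3) :
    ∃ f : C3 → ℂ, ContDiffAt ℂ 1 f 0 ∧ LocalModel Δ p fun q v => v 2 - f q * v 0 := by
  obtain ⟨a, b, ha, hb, hl⟩ := exists_localModel_graph hΔ p
  -- Under (x, y, z) ↦ (x, y, Z) the form becomes (a + Z_x) dx + (b + Z_y) dy + Z_z dz. This choice
  -- of Z kills the dy term, and Z_z = 1 at 0 permits division.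
  obtain ⟨Z, hZ, hZ1, hZ0⟩ := exists_flow 1 hb.neg
  have hZ00 : Z 0 = 0 := hZ0 0 rfl
  have hd := hZ.differentiableAt (by simp)
  have hZ2 : fderiv ℂ Z 0 (Pi.single 2 1) = 1 :=
    fderiv_single_two_of_eq hd fun t => by rw [hZ0 _ (by simp)]; simp
  have hdZ : ∀ k : Fin 3, ContDiffAt ℂ 1 (fun q => fderiv ℂ Z q (Pi.single k 1)) 0 := fun k =>
    (contDiffAt_one_fderiv hZ).clm_apply contDiffAt_const
  have hne : fderiv ℂ Z 0 (Pi.single 2 1) ≠ 0 := by rw [hZ2]; exact one_ne_zero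
  have ha' : ContDiffAt ℂ 1 (fun q => a (shear Z q)) 0 :=
    ContDiffAt.comp (g := a) 0 (by rwa [shear_zero hZ00]) (contDiffAt_shear hZ)
  refine ⟨fun q => -(a (shear Z q) + fderiv ℂ Z q (Pi.single 0 1)) /
    fderiv ℂ Z q (Pi.single 2 1), ((ha'.add (hdZ 0)).neg).div (hdZ 2) hne,
    hl.comp (contDiffAt_shear hZ) (shear_zero hZ00) (isInvertible_fderiv_shear hd hne) ?_⟩
  filter_upwards [hZ1, eventually_differentiableAt hZ,
    (hdZ 2).continuousAt.eventually_ne hne] with q h1 h2 h3 v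
  rw [fderiv_shear h2]
  have h4 := clm_apply_eq (fderiv ℂ Z q) v
  rw [h1] at h4
  have : a (shear Z q) * v 0 + b (shear Z q) * v 1 + fderiv ℂ Z q v =
      fderiv ℂ Z q (Pi.single 2 1) * (v 2 - -(a (shear Z q) + fderiv ℂ Z q (Pi.single 0 1)) /
        fderiv ℂ Z q (Pi.single 2 1) * v 0) := by
    rw [h4]
    field_simp
    simp
    ring
  change a (shear Z q) * v 0 + b (shear Z q) * v 1 + fderiv ℂ Z q v = 0 ↔ _
  rw [this, mul_eq_zero, or_iff_right h3]

/-- Darboux normal form of a contact distribution. -/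
theorem LocalModel.darboux {f : C3 → ℂ} (hf : ContDiffAt ℂ 1 f 0)
    (hl : LocalModel Δ p fun q v => v 2 - f q * v 0) (h1 : fderiv ℂ f 0 (Pi.single 1 1) ≠ 0) :
    LocalModel Δ p fun q v => v 2 - q 1 * v 0 := by
  -- From dz - f dx = d(z - f(0) x) - (f - f(0)) dx, the new y is f - f(0) and the new z is z - f(0)
  -- x; ∂f/∂y ≠ 0 makes K locally invertible.
  set K : C3 → C3 := fun q => ![q 0, f q - f 0, q 2 - f 0 * q 0] with hK
  have hK0 : K 0 = 0 := by ext j; fin_cases j <;> simp [hK]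
  have hKd : ∀ q, DifferentiableAt ℂ f q → HasFDerivAt K (ContinuousLinearMap.pi
      ![ContinuousLinearMap.proj 0, fderiv ℂ f q,
        ContinuousLinearMap.proj 2 - f 0 • ContinuousLinearMap.proj 0]) q := fun q hq => by
    refine hasFDerivAt_pi.2 fun j => ?_
    fin_cases j
    · exact hasFDerivAt_apply (𝕜 := ℂ) 0 q
    · exact hq.hasFDerivAt.sub_const _
    · exact (hasFDerivAt_apply (𝕜 := ℂ) 2 q).sub
        ((hasFDerivAt_apply (𝕜 := ℂ) (0 : Fin 3) q).const_mul (f 0))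
  have hKv : ∀ q, DifferentiableAt ℂ f q → ∀ v,
      fderiv ℂ K q v = ![v 0, fderiv ℂ f q v, v 2 - f 0 * v 0] := fun q hq v => by
    rw [(hKd q hq).fderiv]
    ext j
    fin_cases j <;> simp
  have hKc : ContDiffAt ℂ 1 K 0 := contDiffAt_one_of_eventually
    ((eventually_differentiableAt hf).mono fun q hq => (hKd q hq).differentiableAt)
  have hfd := hf.differentiableAt (by simp)
  have hKinv : (fderiv ℂ K 0).IsInvertible := by
    refine isInvertible_of_injective fun v hv => ?_
    rw [hKv 0 hfd] at hv
    have h0 : v 0 = 0 := congrFun hv 0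
    have h2 : v 2 - f 0 * v 0 = 0 := congrFun hv 2
    have h3 : fderiv ℂ f 0 v = 0 := congrFun hv 1
    have h4 : v 2 = 0 := by simpa [h0] using h2
    rw [clm_apply_eq, h0, h4] at h3
    have h5 : v 1 = 0 := by simpa [h1] using h3
    ext j
    fin_cases j <;> assumption
  obtain ⟨e, he⟩ := hKinv
  have hKe : HasFDerivAt K (e : C3 →L[ℂ] C3) 0 := by
    rw [he]; exact (hKd 0 hfd).differentiableAt.hasFDerivAt
  set H := hKc.localInverse hKe one_ne_zero with hH
  have hHc : ContDiffAt ℂ 1 H 0 := by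
    have := hKc.to_localInverse hKe one_ne_zero
    rwa [hK0] at this
  have hH0 : H 0 = 0 := by
    have := hKc.localInverse_apply_image hKe one_ne_zero
    rwa [hK0] at this
  have hKH : ∀ᶠ q in 𝓝 0, K (H q) = q := by
    have := (hKc.hasStrictFDerivAt' hKe one_ne_zero).eventually_right_inverse
    rwa [hK0] at this
  have htend : Tendsto H (𝓝 0) (𝓝 0) := by
    have := hHc.continuousAt.tendsto; rwa [hH0] at this
  have hchain : ∀ᶠ q in 𝓝 0, DifferentiableAt ℂ f (H q) ∧ K (H q) = q ∧
      ∀ v, fderiv ℂ K (H q) (fderiv ℂ H q v) = v := by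
    filter_upwards [hKH.eventually_nhds, eventually_differentiableAt hHc,
      htend.eventually (eventually_differentiableAt hf)] with q h2 h3 h4
    refine ⟨h4, h2.self_of_nhds, fun v => ?_⟩
    have h5 := fderiv_comp q (hKd _ h4).differentiableAt h3
    have h6 : (K ∘ H) =ᶠ[𝓝 q] id := h2
    rw [h6.fderiv_eq, fderiv_id] at h5
    exact (congrArg (fun L : C3 →L[ℂ] C3 => L v) h5).symm
  refine hl.comp hHc hH0 (isInvertible_of_injective fun v hv => ?_) ?_
  · have := hchain.self_of_nhds.2.2 v
    rw [hv, map_zero] at this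
    exact this.symm
  · filter_upwards [hchain] with q ⟨h2, h3, h4⟩ v
    have h5 := h4 v
    rw [hKv _ h2] at h5
    have e0 : fderiv ℂ H q v 0 = v 0 := congrFun h5 0
    have e2 : fderiv ℂ H q v 2 - f 0 * fderiv ℂ H q v 0 = v 2 := congrFun h5 2
    have e1 : f (H q) - f 0 = q 1 := congrFun h3 1
    have : fderiv ℂ H q v 2 - f (H q) * fderiv ℂ H q v 0 = v 2 - q 1 * v 0 := by
      rw [← e1, ← e2, e0]; ring
    rw [this]

/-- If the slope does not depend on `y`, the distribution is locally the kernel of `dz`. -/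
theorem LocalModel.flatten {f : C3 → ℂ} (hf : ContDiffAt ℂ 1 f 0)
    (hl : LocalModel Δ p fun q v => v 2 - f q * v 0)
    (h1 : ∀ᶠ q in 𝓝 0, fderiv ℂ f q (Pi.single 1 1) = 0) :
    LocalModel Δ p fun _ v => v 2 := by
  set π := squeeze 1 0 with hπ
  have hπ0 : ∀ q : C3, π q = ![q 0, 0, q 2] := fun q => by
    ext j; fin_cases j <;> simp [hπ, squeeze_apply]
  -- The segment from q to its projection to y = 0 stays in the ball, and f has zero derivative
  -- along it.
  have hind : ∀ᶠ q in 𝓝 0, f (π q) = f q := by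
    obtain ⟨r, hr, h⟩ := Metric.eventually_nhds_iff_ball.1 (h1.and (eventually_differentiableAt hf))
    refine Metric.eventually_nhds_iff_ball.2 ⟨r, hr, fun q hq => ?_⟩
    have hd : ∀ θ ∈ Icc (0 : ℝ) 1, HasDerivAt (fun θ : ℝ => f (squeeze 1 (θ : ℂ) q)) 0 θ := by
      intro θ hθ
      obtain ⟨h2, h3⟩ := h _ (squeeze_mem_ball 1 hθ hq)
      have := (h3.hasFDerivAt.restrictScalars ℝ).comp_hasDerivAt θ (hasDerivAt_squeeze 1 q θ)
      refine this.congr_deriv ?_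
      simp [h2]
    have := (convex_Icc (0 : ℝ) 1).norm_image_sub_le_of_norm_hasDerivWithin_le (C := 0)
      (fun θ hθ => (hd θ hθ).hasDerivWithinAt) (fun θ _ => by simp)
      (right_mem_Icc.2 zero_le_one) (left_mem_Icc.2 zero_le_one)
    simp only [zero_mul, norm_le_zero_iff, sub_eq_zero, Complex.ofReal_one, Complex.ofReal_zero,
      squeeze_one] at this
    exact this
  have hfπ : ContDiffAt ℂ 1 (fun q => f (π q)) 0 :=
    ContDiffAt.comp (g := f) 0 (by rwa [map_zero]) π.contDiff.contDiffAt
  obtain ⟨Y, hY, hY1, hY0⟩ := exists_flow 0 hfπ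
  have hπt : Tendsto π (𝓝 0) (𝓝 0) := by simpa using π.continuous.tendsto 0
  -- Composing with the projection removes the y-dependence, so dZ - f dx reduces to Z_z dz.
  set Z : C3 → ℂ := fun q => Y (π q) with hZdef
  have hZ : ContDiffAt ℂ 1 Z 0 := ContDiffAt.comp (g := Y) 0 (by rwa [map_zero])
    π.contDiff.contDiffAt
  have hd := hZ.differentiableAt (by simp)
  have hZ0 : ∀ q, q 0 = 0 → Z q = q 2 := fun q hq => by
    rw [hZdef]; simp only [hπ0]; rw [hY0 _ (by simpa using hq)]; simp
  have hZ00 : Z 0 = 0 := hZ0 0 rfl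
  have hZ2 : fderiv ℂ Z 0 (Pi.single 2 1) = 1 :=
    fderiv_single_two_of_eq hd fun t => by rw [hZ0 _ (by simp)]; simp
  have hne : fderiv ℂ Z 0 (Pi.single 2 1) ≠ 0 := by rw [hZ2]; exact one_ne_zero
  have hst : Tendsto (shear Z) (𝓝 0) (𝓝 0) := by
    have := (contDiffAt_shear hZ).continuousAt.tendsto; rwa [shear_zero hZ00] at this
  refine hl.comp (contDiffAt_shear hZ) (shear_zero hZ00) (isInvertible_fderiv_shear hd hne) ?_
  filter_upwards [hπt.eventually hY1, eventually_differentiableAt hZ,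
    hπt.eventually (eventually_differentiableAt hY), hst.eventually hind,
    ((contDiffAt_one_fderiv hZ).clm_apply (contDiffAt_const (c := (Pi.single 2 1 : C3)))
      ).continuousAt.eventually_ne hne] with q h2 h3 h4 h5 h6 v
  have h7 : fderiv ℂ Z q = (fderiv ℂ Y (π q)).comp π :=
    (h4.hasFDerivAt.comp q π.hasFDerivAt).fderiv
  have hs : π (shear Y (π q)) = π (shear Z q) := by
    rw [hπ0 (shear Y _), hπ0 (shear Z q)]; simp [shear, hZdef, hπ0]
  have e0 : fderiv ℂ Z q (Pi.single 0 1) = f (shear Z q) := by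
    have : π (Pi.single 0 1) = Pi.single 0 1 := by
      rw [hπ0]; ext j; fin_cases j <;> simp
    rw [h7, ContinuousLinearMap.comp_apply, this, h2, if_neg (by decide), zero_add, hs, h5]
  have e1 : fderiv ℂ Z q (Pi.single 1 1) = 0 := by
    rw [h7, ContinuousLinearMap.comp_apply, hπ, squeeze_single, zero_smul, map_zero]
  rw [fderiv_shear h3]
  change fderiv ℂ Z q v - f (shear Z q) * v 0 = 0 ↔ _
  rw [clm_apply_eq, e0, e1]
  rw [show f (shear Z q) * v 0 + 0 * v 1 + fderiv ℂ Z q (Pi.single 2 1) * v 2 -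
    f (shear Z q) * v 0 = fderiv ℂ Z q (Pi.single 2 1) * v 2 by ring, mul_eq_zero,
    or_iff_right h6]

/-- A distribution locally equivalent to the kernel of `dz` has a foliation chart. -/
theorem LocalModel.exists_isFoliationChart (h : LocalModel Δ p fun _ v => v 2) :
    ∃ Φ : OpenPartialHomeomorph C3 C3, IsFoliationChart Δ p Φ := by
  obtain ⟨G, hG, hG0, hinv, hl⟩ := h
  have hev := eventually_isInvertible hG hinv
  obtain ⟨e, he⟩ := hinv
  have hGe : HasFDerivAt G (e : C3 →L[ℂ] C3) 0 := by
    rw [he]; exact (hG.differentiableAt (by simp)).hasFDerivAt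
  set Ψ := hG.toOpenPartialHomeomorph G hGe one_ne_zero with hΨ
  have hΨG : ∀ q, Ψ q = G q := fun q => rfl
  have h0 : (0 : C3) ∈ Ψ.source := hG.mem_toOpenPartialHomeomorph_source hGe one_ne_zero
  have hs : ∀ᶠ q in 𝓝 (0 : C3), q ∈ Ψ.source := Ψ.open_source.mem_nhds h0
  obtain ⟨r, hr, hball⟩ := Metric.eventually_nhds_iff_ball.1
    (hs.and (hl.and (hev.and (eventually_differentiableAt hG))))
  have hsrc : (Ψ.restrOpen (ball 0 r) isOpen_ball).source = ball 0 r := by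
    rw [OpenPartialHomeomorph.restrOpen_source]
    exact inter_eq_right.2 fun q hq => (hball q hq).1
  -- G is restricted before inverting, so that the target of the chart is exactly a polydisc.
  set Φ := (Ψ.restrOpen (ball 0 r) isOpen_ball).symm with hΦ
  have htgt : Φ.target = ball 0 r := hsrc
  have hsymm : ∀ y, Φ.symm y = G y := fun y => rfl
  have hGΦ : ∀ q ∈ Φ.source, G (Φ q) = q := fun q hq => Φ.left_inv hq
  have hmem : ∀ q ∈ Φ.source, Φ q ∈ ball (0 : C3) r := fun q hq => by
    rw [← htgt]; exact Φ.map_source hq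
  have hp : p ∈ Φ.source ∧ Φ p = 0 := by
    have h0' : (0 : C3) ∈ Φ.target := by rw [htgt]; exact mem_ball_self hr
    have h1 := Φ.map_target h0'
    have h2 := Φ.right_inv h0'
    rw [hsymm, hG0] at h1 h2
    exact ⟨h1, h2⟩
  have hder : ∀ q ∈ Φ.source, ∃ A : C3 ≃L[ℂ] C3, fderiv ℂ G (Φ q) = A ∧
      HasFDerivAt Φ (A.symm : C3 →L[ℂ] C3) q := fun q hq => by
    obtain ⟨-, -, ⟨A, hA⟩, h4⟩ := hball _ (hmem q hq)
    refine ⟨A, hA.symm, ?_⟩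
    refine OpenPartialHomeomorph.hasFDerivAt_symm (Ψ.restrOpen (ball 0 r) isOpen_ball) hq ?_
    rw [hA]
    exact h4.hasFDerivAt
  refine ⟨Φ, hp.1, hp.2, ⟨r, hr, htgt⟩, fun q hq => ?_, fun y hy => ?_, fun q hq v => ?_⟩
  · obtain ⟨A, -, hA⟩ := hder q hq
    exact hA.differentiableAt.differentiableWithinAt
  · rw [htgt] at hy
    exact (hball y hy).2.2.2.differentiableWithinAt
  · obtain ⟨A, hA, hA'⟩ := hder q hq
    have h5 := (hball _ (hmem q hq)).2.1 (A.symm v)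
    rw [hA, hGΦ q hq] at h5
    rw [hA'.fderiv]
    simpa using h5

end LocalModels

/-! ### Polynomial admissible curves for the contact form dz - y dx. -/

section Legendrian

/-- A monic quadratic polynomial that is small at a point has a root near that point. -/
theorem exists_root_near (β κ s : ℂ) :
    ∃ r : ℂ, r ^ 2 + β * r + κ = 0 ∧ ‖r - s‖ ^ 2 ≤ ‖s ^ 2 + β * s + κ‖ := by
  obtain ⟨d, hd⟩ := IsAlgClosed.exists_pow_nat_eq (β ^ 2 - 4 * κ) (n := 2) two_pos
  have h1 : ((-β + d) / 2) ^ 2 + β * ((-β + d) / 2) + κ = 0 := by linear_combination hd / 4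
  have h2 : ((-β - d) / 2) ^ 2 + β * ((-β - d) / 2) + κ = 0 := by linear_combination hd / 4
  -- The value at s is the product of the differences from s to the two roots, so the nearer root
  -- satisfies the bound.
  have h3 : s ^ 2 + β * s + κ = ((-β + d) / 2 - s) * ((-β - d) / 2 - s) := by
    linear_combination hd / 4
  rw [h3, norm_mul]
  rcases le_total ‖(-β + d) / 2 - s‖ ‖(-β - d) / 2 - s‖ with h | h
  · exact ⟨_, h1, by rw [sq]; exact mul_le_mul_of_nonneg_left h (norm_nonneg _)⟩
  · exact ⟨_, h2, by rw [sq]; exact mul_le_mul_of_nonneg_right h (norm_nonneg _)⟩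

/-- The value at time `1` of the curve `x = w₀ t + w₂ t³`, `y = w₁ t² + w₂ t³`, `z = ∫ y dx`. -/
noncomputable def endpoint (w : C3) : C3 :=
  ![w 0 + w 2, w 1 + w 2,
    w 0 * w 1 / 3 + 3 / 5 * (w 1 * w 2) + w 0 * w 2 / 4 + w 2 ^ 2 / 2]

/-- The parameters of a curve of the family after the change of time `s ↦ t s`. -/
noncomputable def dilate (t : ℂ) (w : C3) : C3 := ![w 0 * t, w 1 * t ^ 2, w 2 * t ^ 3]

theorem endpoint_zero : endpoint 0 = 0 := by
  ext j; fin_cases j <;> simp [endpoint]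

theorem dilate_zero (w : C3) : dilate 0 w = 0 := by
  ext j; fin_cases j <;> simp [dilate]

theorem dilate_one (w : C3) : dilate 1 w = w := by
  ext j; fin_cases j <;> simp [dilate]

theorem dilate_mul (s t : ℂ) (w : C3) : dilate (s * t) w = dilate s (dilate t w) := by
  ext j; fin_cases j <;> simp [dilate] <;> ring

theorem norm_dilate_le {t : ℂ} (ht : ‖t‖ ≤ 1) (w : C3) : ‖dilate t w‖ ≤ ‖w‖ := by
  refine (pi_norm_le_iff_of_nonneg (norm_nonneg w)).2 fun j => ?_
  have h : ∀ (k : Fin 3) (n : ℕ), ‖w k * t ^ n‖ ≤ ‖w‖ := fun k n => by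
    rw [norm_mul, norm_pow]
    exact (mul_le_of_le_one_right (norm_nonneg _) (pow_le_one₀ (norm_nonneg _) ht)).trans
      (norm_le_pi_norm w k)
  fin_cases j
  · simpa [dilate] using h 0 1
  · exact h 1 2
  · exact h 2 3

theorem continuous_dilate (w : C3) : Continuous fun t => dilate t w := by
  refine continuous_pi fun j => ?_
  fin_cases j <;> simp only [dilate] <;> simp <;> fun_prop

theorem continuous_endpoint : Continuous endpoint := by
  refine continuous_pi fun j => ?_
  fin_cases j <;> simp only [endpoint] <;> simp <;> fun_prop

/-- The differential is singular at 0, so the inverse function theorem does not apply there.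
Instead, eliminating w 0 and w 1 leaves a quadratic equation for w 2, whose roots exist over ℂ and
depend continuously on the endpoint. -/
theorem isOpenMap_endpoint : IsOpenMap endpoint := by
  rw [isOpenMap_iff_nhds_le]
  intro w T hT
  obtain ⟨ε, hε, hball⟩ := Metric.mem_nhds_iff.1 hT
  -- Substituting w 0 = q 0 - r and w 1 = q 1 - r in the third coordinate gives -r²/60 plus
  -- lower-order terms; multiplying by -60 makes the equation monic.
  set P : C3 → ℂ := fun q => w 2 ^ 2 + (5 * q 0 - 16 * q 1) * w 2 + (60 * q 2 - 20 * q 0 * q 1)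
    with hP
  have hP0 : P (endpoint w) = 0 := by simp [hP, endpoint]; ring
  have hPc : Continuous P := by fun_prop
  have h1 : ∀ᶠ q in 𝓝 (endpoint w), ‖P q‖ < (ε / 4) ^ 2 := by
    refine hPc.norm.continuousAt.eventually (gt_mem_nhds ?_)
    simp only [hP0, norm_zero]; positivity
  filter_upwards [h1, Metric.ball_mem_nhds (endpoint w) (show 0 < ε / 4 by positivity)] with q h2 h3
  obtain ⟨r, hr, hrs⟩ := exists_root_near (5 * q 0 - 16 * q 1) (60 * q 2 - 20 * q 0 * q 1) (w 2)
  have h4 : ‖r - w 2‖ < ε / 4 := lt_of_pow_lt_pow_left₀ 2 (by positivity) (hrs.trans_lt h2)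
  rw [mem_ball, dist_eq_norm] at h3
  have h5 := (norm_le_pi_norm (q - endpoint w) 0).trans_lt h3
  have h6 := (norm_le_pi_norm (q - endpoint w) 1).trans_lt h3
  simp only [Pi.sub_apply, endpoint, Matrix.cons_val_zero, Matrix.cons_val_one] at h5 h6
  have hw : endpoint ![q 0 - r, q 1 - r, r] = q := by
    ext j
    fin_cases j
    · simp [endpoint]
    · simp [endpoint]
    · simp [endpoint]
      linear_combination -hr / 60
  rw [← hw]
  refine hball ?_
  rw [mem_ball, dist_eq_norm]
  refine (pi_norm_lt_iff hε).2 fun j => ?_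
  have key : ∀ a b : ℂ, ‖a - (b + w 2)‖ < ε / 4 → ‖a - r - b‖ < ε := fun a b h => by
    have : a - r - b = (a - (b + w 2)) - (r - w 2) := by ring
    rw [this]
    exact (norm_sub_le _ _).trans_lt (by linarith)
  fin_cases j
  · exact key _ _ h5
  · exact key _ _ h6
  · exact h4.trans (by linarith)

/-- Dilating the parameters by t turns the endpoint into the position at time t, and the third
coordinate is the primitive of y x' vanishing at t = 0. -/
theorem hasDerivAt_endpoint_dilate (w : C3) (t : ℂ) :
    ∃ v : C3, HasDerivAt (fun t => endpoint (dilate t w)) v t ∧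
      v 2 - endpoint (dilate t w) 1 * v 0 = 0 := by
  have hp : ∀ n : ℕ, HasDerivAt (fun t : ℂ => t ^ n) (n * t ^ (n - 1)) t := fun n =>
    hasDerivAt_pow n t
  have hx : HasDerivAt (fun t : ℂ => w 0 * t + w 2 * t ^ 3) (w 0 + w 2 * (3 * t ^ 2)) t := by
    exact (((hasDerivAt_id t).const_mul (w 0)).add ((hp 3).const_mul (w 2))).congr_deriv
      (by norm_num)
  have hy : HasDerivAt (fun t : ℂ => w 1 * t ^ 2 + w 2 * t ^ 3)
      (w 1 * (2 * t) + w 2 * (3 * t ^ 2)) t := by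
    exact (((hp 2).const_mul (w 1)).add ((hp 3).const_mul (w 2))).congr_deriv (by norm_num)
  have hz : HasDerivAt (fun t : ℂ => w 0 * w 1 / 3 * t ^ 3 + 3 / 5 * (w 1 * w 2) * t ^ 5 +
      w 0 * w 2 / 4 * t ^ 4 + w 2 ^ 2 / 2 * t ^ 6)
      (w 0 * w 1 / 3 * (3 * t ^ 2) + 3 / 5 * (w 1 * w 2) * (5 * t ^ 4) +
        w 0 * w 2 / 4 * (4 * t ^ 3) + w 2 ^ 2 / 2 * (6 * t ^ 5)) t := by
    exact (((((hp 3).const_mul (w 0 * w 1 / 3)).add ((hp 5).const_mul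
      (3 / 5 * (w 1 * w 2)))).add ((hp 4).const_mul (w 0 * w 2 / 4))).add
      ((hp 6).const_mul (w 2 ^ 2 / 2))).congr_deriv (by norm_num)
  refine ⟨![w 0 + w 2 * (3 * t ^ 2), w 1 * (2 * t) + w 2 * (3 * t ^ 2),
    w 0 * w 1 / 3 * (3 * t ^ 2) + 3 / 5 * (w 1 * w 2) * (5 * t ^ 4) +
      w 0 * w 2 / 4 * (4 * t ^ 3) + w 2 ^ 2 / 2 * (6 * t ^ 5)],
    hasDerivAt_pi.2 fun j => ?_, ?_⟩
  · fin_cases j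
    · exact hx
    · exact hy
    · refine hz.congr_of_eventuallyEq (Eventually.of_forall fun t => ?_)
      simp [endpoint, dilate]
      ring
  · simp [endpoint, dilate]
    ring

end Legendrian

/-! ### Accessibility at contact points and integrability. -/

variable {Δ : PlaneField} {p : C3}

/-- Near a point at which a distribution is contact, some neighbourhood of the point is filled by
admissible curves that stay in it. -/
theorem LocalModel.exists_accessible (h : LocalModel Δ p fun q v => v 2 - q 1 * v 0) :
    ∃ U : Set C3, IsOpen U ∧ p ∈ U ∧ ∀ q ∈ U, AccessibleWithin Δ U p q := by
  obtain ⟨G, hG, hG0, ⟨e, he⟩, hl⟩ := h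
  have hGe : HasFDerivAt G (e : C3 →L[ℂ] C3) 0 := by
    rw [he]; exact (hG.differentiableAt (by simp)).hasFDerivAt
  set Ψ := hG.toOpenPartialHomeomorph G hGe one_ne_zero with hΨ
  have h0 : (0 : C3) ∈ Ψ.source := hG.mem_toOpenPartialHomeomorph_source hGe one_ne_zero
  have hs : ∀ᶠ q in 𝓝 (0 : C3), q ∈ Ψ.source := Ψ.open_source.mem_nhds h0
  have htend : Tendsto endpoint (𝓝 0) (𝓝 0) := by
    simpa [endpoint_zero] using continuous_endpoint.tendsto 0
  obtain ⟨δ, hδ, hball⟩ := Metric.eventually_nhds_iff_ball.1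
    (htend.eventually (hs.and (hl.and (eventually_differentiableAt hG))))
  have hsub : endpoint '' ball 0 δ ⊆ Ψ.source := by
    rintro _ ⟨w, hw, rfl⟩
    exact (hball w hw).1
  -- U consists of the endpoints themselves: a curve whose dilated parameters stay in the ball stays
  -- in U automatically.
  refine ⟨G '' (endpoint '' ball 0 δ),
    Ψ.isOpen_image_of_subset_source (isOpenMap_endpoint _ isOpen_ball) hsub,
    ⟨0, ⟨0, mem_ball_self hδ, endpoint_zero⟩, hG0⟩, ?_⟩
  rintro _ ⟨_, ⟨w, hw, rfl⟩, rfl⟩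
  set D : Set ℂ := {t | dilate t w ∈ ball (0 : C3) δ} with hD
  have h0D : (0 : ℂ) ∈ D := by
    simp only [hD, mem_ofPred_eq, dilate_zero]; exact mem_ball_self hδ
  have h1D : (1 : ℂ) ∈ D := by simpa only [hD, mem_ofPred_eq, dilate_one] using hw
  -- Dilation by a real factor in [0, 1] does not increase the norm, so the time domain is
  -- star-shaped about 0 and hence connected.
  have hstar : StarConvex ℝ (0 : ℂ) D := by
    rw [starConvex_zero_iff]
    intro t ht a ha0 ha1
    simp only [hD, mem_ofPred_eq, mem_ball_zero_iff] at ht ⊢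
    rw [Complex.real_smul, dilate_mul]
    refine (norm_dilate_le ?_ _).trans_lt ht
    rwa [Complex.norm_real, Real.norm_of_nonneg ha0]
  have hder : ∀ t ∈ D, ∃ v : C3, HasDerivAt (fun t => G (endpoint (dilate t w)))
      (fderiv ℂ G (endpoint (dilate t w)) v) t ∧
      v 2 - endpoint (dilate t w) 1 * v 0 = 0 := fun t ht => by
    obtain ⟨v, hv, hv0⟩ := hasDerivAt_endpoint_dilate w t
    exact ⟨v, (hball _ ht).2.2.hasFDerivAt.comp_hasDerivAt t hv, hv0⟩
  refine ⟨D, fun t => G (endpoint (dilate t w)), ⟨?_, ?_, fun t ht => ?_, fun t ht => ?_⟩,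
    fun t ht => ⟨_, ⟨_, ht, rfl⟩, rfl⟩, 0, h0D, 1, h1D, ?_, ?_⟩
  · exact isOpen_ball.preimage (continuous_dilate w)
  · exact (hstar.isPathConnected h0D).isConnected
  · obtain ⟨v, hv, -⟩ := hder t ht
    exact hv.differentiableAt.differentiableWithinAt
  · obtain ⟨v, hv, hv0⟩ := hder t ht
    rw [hv.deriv]
    exact ((hball _ ht).2.1 v).2 hv0
  · simp only [dilate_zero, endpoint_zero, hG0]
  · simp only [dilate_one]

theorem isIntegrable_of_inaccessible (hΔ : IsHolomorphicHyperplaneDistribution Δ)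
    (hinacc : ∀ p : C3, ∀ U : Set C3, IsOpen U → p ∈ U → ∃ q ∈ U, ¬ AccessibleWithin Δ U p q) :
    IsIntegrable Δ := by
  intro p
  obtain ⟨f, hf, hl⟩ := exists_localModel_slope hΔ p
  refine (hl.flatten hf ?_).exists_isFoliationChart
  filter_upwards [hl.recenter, hf.eventually (by simp)] with a ⟨p', ha⟩ hfa
  -- A nearby point with ∂f/∂y ≠ 0 is a contact point, and the hypothesis is applied at its image p'
  -- rather than at p.
  by_contra hne
  have hfa' : ContDiffAt ℂ 1 (fun q => f (a + q)) 0 :=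
    ContDiffAt.comp (g := f) 0 (by simpa using hfa) (by fun_prop)
  obtain ⟨U, hU, hpU, hacc⟩ :=
    (LocalModel.darboux hfa' ha (by rw [fderiv_comp_add_left, add_zero]; exact hne)
      ).exists_accessible
  obtain ⟨q, hq, hq'⟩ := hinacc p' U hU hpU
  exact hq' (hacc q hq)

/-! ### The Frobenius condition ω ∧ dω = 0. -/

theorem dOne_apply {ω : OneForm} {q : C3} (hω : DifferentiableAt ℂ ω q) (v w : C3) :
    dOne ω q ![v, w] = fderiv ℂ ω q v w - fderiv ℂ ω q w v := by
  have hd : DifferentiableAt ℂ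
      (fun x : C3 => ContinuousAlternatingMap.ofSubsingleton ℂ C3 ℂ (0 : Fin 1) (ω x)) q :=
    (ContinuousAlternatingMap.ofSubsingletonLIE (𝕜 := ℂ) (E := C3) (F := ℂ) (0 : Fin 1)
      ).toContinuousLinearEquiv.differentiableAt.comp q hω
  rw [dOne, extDeriv_apply hd]
  have h : ∀ a b : C3, fderiv ℂ (fun x => ω x a) q b = fderiv ℂ ω q b a := fun a b => by
    rw [fderiv_clm_apply hω (differentiableAt_const a)]
    simp
  have h1 : Fin.removeNth 1 ![v, w] 0 = v := rfl
  simp [Fin.sum_univ_two, h1, h, sub_eq_add_neg]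

/-- Two forms with the same kernels are proportional, so ω = h dφ near q and dω = dh ∧ dφ by
symmetry of the second derivative of φ; wedging with ω repeats dφ. -/
theorem wedge_dOne_eq_zero (hΔ : IsIntegrable Δ) {U : Set C3} {ω : OneForm} (hU : IsOpen U)
    (hω : DefinesOn ω U Δ) {q : C3} (hq : q ∈ U) (u v w : C3) :
    wedgeOneTwo (ω q) (dOne ω q) u v w = 0 := by
  obtain ⟨Φ, hΦ⟩ := hΔ q
  set φ : C3 → ℂ := fun x => Φ x 2 with hφ
  have hΦd : ∀ᶠ x in 𝓝 q, DifferentiableAt ℂ Φ x :=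
    Filter.mem_of_superset (Φ.open_source.mem_nhds hΦ.mem_source) fun x hx =>
      hΦ.holomorphic.differentiableAt (Φ.open_source.mem_nhds hx)
  have hφd : ∀ᶠ x in 𝓝 q, DifferentiableAt ℂ φ x := hΦd.mono fun x hx =>
    differentiableAt_pi.1 hx 2
  have hker : ∀ᶠ x in 𝓝 q, ∀ v, ω x v = 0 ↔ fderiv ℂ φ x v = 0 := by
    have h1 : ∀ᶠ x in 𝓝 q, x ∈ Φ.source := Φ.open_source.mem_nhds hΦ.mem_source
    have h2 : ∀ᶠ x in 𝓝 q, x ∈ U := hU.mem_nhds hq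
    filter_upwards [h1, h2, hΦd] with x h1 h2 h3 v
    rw [← hω.mem_iff x h2, hΦ.tangent x h1, fderiv_apply h3]
    rfl
  have hωd := hω.holomorphic.differentiableAt (hU.mem_nhds hq)
  obtain ⟨a, ha⟩ : ∃ a, ω q a ≠ 0 := by
    by_contra! h
    exact hω.ne_zero q hq (ContinuousLinearMap.ext h)
  have ha' : fderiv ℂ φ q a ≠ 0 := fun h => ha ((hker.self_of_nhds a).2 h)
  have hφ2 : DifferentiableAt ℂ (fderiv ℂ φ) q := 
    (eventually_differentiableAt_fderiv hφd).self_of_nhds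
  have hφa : DifferentiableAt ℂ (fun x => fderiv ℂ φ x a) q :=
    hφ2.clm_apply (differentiableAt_const a)
  have hωa : DifferentiableAt ℂ (fun x => ω x a) q := hωd.clm_apply (differentiableAt_const a)
  -- Evaluating both forms on one fixed vector a off the kernel at q exhibits the proportionality
  -- factor as a holomorphic quotient.
  set h : C3 → ℂ := fun x => ω x a / fderiv ℂ φ x a with hh
  have hhd : DifferentiableAt ℂ h q := by
    simp only [hh, div_eq_mul_inv]
    exact hωa.mul (hφa.fun_inv ha')
  have heq : ω =ᶠ[𝓝 q] fun x => h x • fderiv ℂ φ x := by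
    filter_upwards [hker, hφa.continuousAt.eventually_ne ha'] with x hx hxa
    ext v
    have h1 : ω x (v - (fderiv ℂ φ x v / fderiv ℂ φ x a) • a) = 0 := by
      rw [hx, map_sub, map_smul, smul_eq_mul, div_mul_cancel₀ _ hxa, sub_self]
    rw [map_sub, map_smul, sub_eq_zero] at h1
    rw [h1, smul_apply, smul_eq_mul, smul_eq_mul, hh]
    ring
  have hfd : ∀ v w, fderiv ℂ ω q v w =
      h q * fderiv ℂ (fderiv ℂ φ) q v w + fderiv ℂ h q v * fderiv ℂ φ q w := fun v w => by
    rw [heq.fderiv_eq, fderiv_fun_smul hhd hφ2]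
    simp
  have hsymm : ∀ v w, fderiv ℂ (fderiv ℂ φ) q v w = fderiv ℂ (fderiv ℂ φ) q w v :=
    second_derivative_symmetric_of_eventually (hφd.mono fun x hx => hx.hasFDerivAt)
      hφ2.hasFDerivAt
  have hωq : ∀ v, ω q v = h q * fderiv ℂ φ q v := fun v => by
    rw [heq.eq_of_nhds]; simp
  simp only [wedgeOneTwo, dOne_apply hωd, hfd, hωq]
  rw [hsymm w v, hsymm w u, hsymm v u]
  ring

end HolDist

theorem mainTheorem1
    (Δ : HolDist.PlaneField)
    (hΔ : HolDist.IsHolomorphicHyperplaneDistribution Δ)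
    (hinacc : ∀ p : HolDist.C3, ∀ U : Set HolDist.C3, IsOpen U → p ∈ U →
      ∃ q ∈ U, ¬ HolDist.AccessibleWithin Δ U p q) :
    HolDist.IsIntegrable Δ ∧
      ∀ (U : Set HolDist.C3) (ω : HolDist.OneForm), IsOpen U → HolDist.DefinesOn ω U Δ →
        ∀ q ∈ U, ∀ u v w : HolDist.C3,
          HolDist.wedgeOneTwo (ω q) (HolDist.dOne ω q) u v w = 0 :=
  have h := HolDist.isIntegrable_of_inaccessible hΔ hinacc
  ⟨h, fun _ _ hU hω _ hq u v w => HolDist.wedge_dOne_eq_zero h hU hω hq u v w⟩
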